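/- For $b,\mu>0$ and integers $j\ge 2$ let $$I^{\pm}_{1,j,1}(b,\mu)=\int_0^\infty\frac{x}{(x^2+b^2)^j(e^{\mu x}\pm1)}\,dx,\qquad \hat I^{\pm}_{1,j,1}(b)=I^{\pm}_{1,j,1}(b,1).$$ These integrals converge absolutely, and $I^{+}_{1,j,1}(b,\mu)=\mu^{2j-2}\,\hat I^{+}_{1,j,1}(b\mu)$. Let $\psi^{(i)}$ denote the $i$-th derivative of the digamma function $\psi=\Gamma'/\Gamma$. Then there are real constants $\gamma^+_{j,i}$ ($j\ge2$, $0\le i\le j-1$), independent of $b$ and $\mu$, such that for all $j\ge 2$ and $b,\mu>0$ $$\hat I^+_{1,j,1}(b\mu)=\gamma^+_{j,0}\frac{1}{(b\mu)^{2j-2}}+\sum_{i=1}^{j-1}(-1)^i\gamma^+_{j,i}\frac{1}{(b\mu)^{2j-i-2}\pi^i}\,\psi^{(i)}\!\left(\frac{b\mu}{2\pi}+\frac12\right).\qquad(1)$$ A family of real constants $\gamma^+_{j,i}$ satisfies (1) for all $j\ge2$ and $b,\mu>0$ if and only if $\gamma^+_{2,0}=\frac14$, $\gamma^+_{2,1}=\frac18$,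 and for all $j>2$ $$\gamma^+_{j,i}=\begin{cases}\frac{j-2}{j-1}\gamma^+_{j-1,i}, & i=0;\\ \frac{2j-i-4}{2j-2}\gamma^+_{j-1,i}, & i=1;\\ \frac{2j-i-4}{2j-2}\gamma^+_{j-1,i}+\frac1{4(j-1)}\gamma^+_{j-1,i-1}, & 2\le i<j-1;\\ \frac1{4(j-1)}\gamma^+_{j-1,i-1}, & i=j-1.\end{cases}$$ Likewise there are real constants $\gamma^-_{j,i}$ ($j\ge2$, $-1\le i\le j-1$) such that for all $j\ge 2$ and $b,\mu>0$ $$\hat I^-_{1,j,1}(b\mu)=-\gamma^-_{j,-1}\frac{\pi}{(b\mu)^{2j-1}}-\gamma^-_{j,0}\frac{1}{(b\mu)^{2j-2}}-\sum_{i=1}^{j-1}(-1)^i\gamma^-_{j,i}\frac{1}{(b\mu)^{2j-i-2}\pi^i}\,\psi^{(i)}\!\left(\frac{b\mu}{2\pi}\right),\qquad(2)$$ and whenever $\gamma^+$ satisfies (1) and $\gamma^-$ satisfies (2) for all $j\ge2$ and $b,\mu>0$, one has $\gamma^+_{j,i}=\gamma^-_{j,i}$ for all $j\ge2$ and $0\le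 i\le j-1$. -/

import Mathlib

/-- The integrand `x ^ n / ((x ^ 2 + b ^ 2) ^ j (e ^ (μ x) + 1) ^ s)`. -/
noncomputable def kernelPlus (n j s : ℕ) (b μ x : ℝ) : ℝ :=
  x ^ n / ((x ^ 2 + b ^ 2) ^ j * (Real.exp (μ * x) + 1) ^ s)

/-- The integrand `x ^ n / ((x ^ 2 + b ^ 2) ^ j (e ^ (μ x) - 1) ^ s)`. -/
noncomputable def kernelMinus (n j s : ℕ) (b μ x : ℝ) : ℝ :=
  x ^ n / ((x ^ 2 + b ^ 2) ^ j * (Real.exp (μ * x) - 1) ^ s)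

/-- The integral `I⁺_{n,j,s}(b, μ)` over `(0, ∞)`. -/
noncomputable def assocPlus (n j s : ℕ) (b μ : ℝ) : ℝ :=
  ∫ x in Set.Ioi (0 : ℝ), kernelPlus n j s b μ x

/-- The integral `I⁻_{n,j,s}(b, μ)` over `(0, ∞)`. -/
noncomputable def assocMinus (n j s : ℕ) (b μ : ℝ) : ℝ :=
  ∫ x in Set.Ioi (0 : ℝ), kernelMinus n j s b μ x

/-- The normal form `Î⁺_{n,j,s}(b) = I⁺_{n,j,s}(b, 1)`. -/
noncomputable def hatPlus (n j s : ℕ) (b : ℝ) : ℝ := assocPlus n j s b 1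

/-- The normal form `Î⁻_{n,j,s}(b) = I⁻_{n,j,s}(b, 1)`. -/
noncomputable def hatMinus (n j s : ℕ) (b : ℝ) : ℝ := assocMinus n j s b 1

/-- The polygamma function `ψ^{(i)}`, the `i`-th derivative of the digamma function. -/
noncomputable def polygamma (i : ℕ) (z : ℂ) : ℂ := iteratedDeriv i Complex.digamma z

/-- The constants `c 0, …, c (j - 1)` are expansion coefficients of `Î⁺_{1,j,1}(b μ)`.
For `j ≥ 2` and `i ≤ j - 1` the natural-number subtractions below do not truncate. -/
def IsPlusExpansion (j : ℕ) (c : ℕ → ℝ) : Prop :=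
  ∀ b μ : ℝ, 0 < b → 0 < μ →
    (hatPlus 1 j 1 (b * μ) : ℂ) =
      (c 0 : ℂ) * (1 / ((b : ℂ) * μ) ^ (2 * j - 2)) +
        ∑ i ∈ Finset.Icc 1 (j - 1),
          (-1 : ℂ) ^ i * (c i : ℂ) *
            (1 / (((b : ℂ) * μ) ^ (2 * j - i - 2) * (Real.pi : ℂ) ^ i)) *
            polygamma i ((b : ℂ) * μ / (2 * Real.pi) + 1 / 2)

/-- The constants `c (-1), c 0, …, c (j - 1)` are expansion coefficients of `Î⁻_{1,j,1}(b μ)`. -/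
def IsMinusExpansion (j : ℕ) (c : ℤ → ℝ) : Prop :=
  ∀ b μ : ℝ, 0 < b → 0 < μ →
    (hatMinus 1 j 1 (b * μ) : ℂ) =
      -(c (-1) : ℂ) * ((Real.pi : ℂ) / ((b : ℂ) * μ) ^ (2 * j - 1)) -
        (c 0 : ℂ) * (1 / ((b : ℂ) * μ) ^ (2 * j - 2)) -
        ∑ i ∈ Finset.Icc 1 (j - 1),
          (-1 : ℂ) ^ i * (c (i : ℤ) : ℂ) *
            (1 / (((b : ℂ) * μ) ^ (2 * j - i - 2) * (Real.pi : ℂ) ^ i)) *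
            polygamma i ((b : ℂ) * μ / (2 * Real.pi))

/-- The initial values at `j = 2` and the recursion for `j > 2`. -/
def PlusRecursion (γ : ℕ → ℕ → ℝ) : Prop :=
  γ 2 0 = 1 / 4 ∧ γ 2 1 = 1 / 8 ∧
    ∀ j : ℕ, 2 < j →
      γ j 0 = ((j : ℝ) - 2) / ((j : ℝ) - 1) * γ (j - 1) 0 ∧
      γ j 1 = (2 * (j : ℝ) - 1 - 4) / (2 * (j : ℝ) - 2) * γ (j - 1) 1 ∧
      (∀ i : ℕ, 2 ≤ i → i < j - 1 →
        γ j i = (2 * (j : ℝ) - (i : ℝ) - 4) / (2 * (j : ℝ) - 2) * γ (j - 1) i +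
          1 / (4 * ((j : ℝ) - 1)) * γ (j - 1) (i - 1)) ∧
      γ j (j - 1) = 1 / (4 * ((j : ℝ) - 1)) * γ (j - 1) (j - 2)

/-! Differentiating `∫ g(x) / (x² + a²)^j dx` in `a` gives `-2ja` times the same integral with
exponent `j + 1`, so the case `j = 2` determines all larger `j`. On the expansion side, `d/da`
either lowers a power of `a` or raises the order of a polygamma with a factor `1/(2π)`; collecting
terms is exactly the stated recursion (`hasDerivAt_polygammaSum`, `eq_of_deriv_recursion`). The
shift in the polygamma argument plays no role there, which is why both signs share their
coefficients.

For `j = 2` and the minus sign, the Mittag-Leffler series of the cotangent expands `y / (e^y - 1)`;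
integrated term by term it becomes a trigamma series (`hatMinus_two`). The plus sign follows from
`1/(e^x + 1) = 1/(e^x - 1) - 2/(e^(2x) - 1)` and the duplication formula for trigamma
(`hatPlus_two`).

The "only if" direction and `γ⁺ = γ⁻` need uniqueness of the coefficients. A linear relation on a
real ray continues to the right half-plane, and polygammas of different orders have poles of
different orders at `0` (`coeff_eq_zero_of_sum_polygamma_ofReal_eq_zero`). -/

open Filter Topology

/-! ### Polygamma functions on the right half-plane. -/

theorem Complex.ne_neg_nat_of_re_pos {z : ℂ} (hz : 0 < z.re) (m : ℕ) : z ≠ -m := by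
  rintro rfl
  simp only [Complex.neg_re, Complex.natCast_re] at hz
  have : (0 : ℝ) ≤ m := m.cast_nonneg
  linarith

theorem isOpen_re_pos : IsOpen {z : ℂ | 0 < z.re} :=
  Complex.continuous_re.isOpen_preimage _ isOpen_Ioi

theorem differentiableAt_Gamma_of_re_pos {z : ℂ} (hz : 0 < z.re) :
    DifferentiableAt ℂ Complex.Gamma z :=
  Complex.differentiableAt_Gamma z (Complex.ne_neg_nat_of_re_pos hz)

theorem analyticOnNhd_digamma : AnalyticOnNhd ℂ Complex.digamma {z : ℂ | 0 < z.re} := by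
  have h : AnalyticOnNhd ℂ Complex.Gamma {z : ℂ | 0 < z.re} :=
    DifferentiableOn.analyticOnNhd
      (fun z hz => (differentiableAt_Gamma_of_re_pos hz).differentiableWithinAt) isOpen_re_pos
  exact h.deriv.div h fun z hz => Complex.Gamma_ne_zero_of_re_pos hz

theorem analyticOnNhd_polygamma (i : ℕ) : AnalyticOnNhd ℂ (polygamma i) {z : ℂ | 0 < z.re} := by
  have h : polygamma i = deriv^[i] Complex.digamma := by
    funext z
    rw [polygamma, iteratedDeriv_eq_iterate]
  rw [h]
  exact analyticOnNhd_digamma.iterated_deriv i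

theorem hasDerivAt_polygamma (i : ℕ) {z : ℂ} (hz : 0 < z.re) :
    HasDerivAt (polygamma i) (polygamma (i + 1) z) z := by
  have h := (analyticOnNhd_polygamma i z hz).differentiableAt.hasDerivAt
  have e : deriv (polygamma i) z = polygamma (i + 1) z := by
    rw [polygamma, iteratedDeriv_succ]
    rfl
  rwa [e] at h

theorem polygamma_add_one (i : ℕ) {z : ℂ} (hz : 0 < z.re) :
    polygamma i (z + 1) = polygamma i z + (-1) ^ i * i.factorial / z ^ (i + 1) := by
  induction i generalizing z with
  | zero =>
    simpa [polygamma] using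
      Complex.digamma_apply_add_one z (Complex.ne_neg_nat_of_re_pos hz)
  | succ i ih =>
    have hz0 : z ≠ 0 := by
      rintro rfl
      simp at hz
    have h1 : HasDerivAt (fun w => polygamma i (w + 1)) (polygamma (i + 1) (z + 1)) z :=
      (hasDerivAt_polygamma i (z := z + 1)
        (by simp only [Complex.add_re, Complex.one_re]; linarith)).comp_add_const z 1
    have h2 := (hasDerivAt_polygamma i hz).add
      (((hasDerivAt_pow (i + 1) z).inv (pow_ne_zero _ hz0)).const_mul
        ((-1 : ℂ) ^ i * i.factorial))
    have h3 := h1.congr_of_eventuallyEq (f₁ := fun w => polygamma i w +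
        (-1) ^ i * i.factorial * (w ^ (i + 1))⁻¹) (by
      filter_upwards [isOpen_re_pos.mem_nhds hz] with w hw
      rw [ih hw]
      rfl)
    rw [h3.unique h2, Nat.factorial_succ]
    congr 1
    push_cast
    field_simp
    ring

/-! ### Digamma on the positive reals and the trigamma series. -/

theorem digamma_ofReal {x : ℝ} (hx : 0 < x) :
    Complex.digamma x = (logDeriv Real.Gamma x : ℝ) := by
  have h1 := (differentiableAt_Gamma_of_re_pos (z := x) (by simpa using hx)).hasDerivAt.comp_ofReal
  have h2 := (Real.differentiableOn_Gamma_Ioi.differentiableAt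
    (Ioi_mem_nhds hx)).hasDerivAt.ofReal_comp
  simp only [← Complex.Gamma_ofReal] at h2
  rw [Complex.digamma_def, logDeriv_apply, logDeriv_apply, h1.unique h2, Complex.Gamma_ofReal]
  push_cast
  rfl

theorem logDeriv_Gamma_add_one {x : ℝ} (hx : 0 < x) :
    logDeriv Real.Gamma (x + 1) = logDeriv Real.Gamma x + 1 / x := by
  have h := Complex.digamma_apply_add_one x
    (Complex.ne_neg_nat_of_re_pos (by simpa using hx))
  have h1 := digamma_ofReal (x := x + 1) (by linarith)
  push_cast at h1
  rw [h1, digamma_ofReal hx] at h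
  rw [one_div]
  exact_mod_cast h

theorem logDeriv_Gamma_add_nat {x : ℝ} (hx : 0 < x) (N : ℕ) :
    logDeriv Real.Gamma (x + N) =
      logDeriv Real.Gamma x + ∑ n ∈ Finset.range N, 1 / (x + n) := by
  induction N with
  | zero => simp
  | succ N ih =>
    rw [Finset.sum_range_succ, ← add_assoc, ← ih, ← logDeriv_Gamma_add_one (by positivity)]
    push_cast
    rw [add_assoc]

/-- Log-convexity of Gamma, as in Bohr–Mollerup; together with the recurrence it controls digamma at
infinity. -/
theorem monotoneOn_logDeriv_Gamma : MonotoneOn (logDeriv Real.Gamma) (Set.Ioi 0) := by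
  have hd : ∀ x ∈ Set.Ioi (0 : ℝ), HasDerivAt (Real.log ∘ Real.Gamma) (logDeriv Real.Gamma x) x := by
    intro x hx
    have h := (Real.differentiableOn_Gamma_Ioi.differentiableAt (Ioi_mem_nhds hx)).hasDerivAt.log
      (Real.Gamma_pos_of_pos hx).ne'
    simpa [logDeriv_apply] using! h
  have h := Real.convexOn_log_Gamma.monotoneOn_deriv fun x hx => (hd x hx).differentiableAt
  exact h.congr fun x hx => (hd x hx).deriv

/-- For a natural `m ≥ x`, monotonicity bounds digamma at `x + N` by its value at `y + N + m`, and
the `m` recurrence steps back to `y + N` cost at most `1 / (y + N)` each. -/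
theorem exists_logDeriv_Gamma_sub_le {x y : ℝ} (hx : 0 < x) (hy : 0 < y) :
    ∃ m : ℕ, ∀ N : ℕ,
      logDeriv Real.Gamma (x + N) - logDeriv Real.Gamma (y + N) ≤ m / (y + N) := by
  obtain ⟨m, hm⟩ := exists_nat_ge x
  refine ⟨m, fun N => ?_⟩
  have h1 : logDeriv Real.Gamma (x + N) ≤ logDeriv Real.Gamma (y + N + m) :=
    monotoneOn_logDeriv_Gamma (by simp only [Set.mem_Ioi]; positivity)
      (by simp only [Set.mem_Ioi]; positivity) (by linarith)
  rw [logDeriv_Gamma_add_nat (x := y + N) (by positivity)] at h1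
  have h2 : ∑ n ∈ Finset.range m, 1 / (y + N + n) ≤ m / (y + N) := by
    calc ∑ n ∈ Finset.range m, 1 / (y + N + n) ≤ ∑ n ∈ Finset.range m, 1 / (y + N) := by
          refine Finset.sum_le_sum fun n _ => ?_
          exact one_div_le_one_div_of_le (by positivity)
            (le_add_of_nonneg_right n.cast_nonneg)
      _ = m / (y + N) := by
          rw [Finset.sum_const, Finset.card_range, nsmul_eq_mul]
          ring
  linarith

theorem tendsto_const_div_add_nat (m y : ℝ) :
    Tendsto (fun N : ℕ => m / (y + N)) atTop (𝓝 0) :=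
  tendsto_const_nhds.div_atTop
    (tendsto_atTop_add_const_left _ _ tendsto_natCast_atTop_atTop)

theorem tendsto_logDeriv_Gamma_sub {x y : ℝ} (hx : 0 < x) (hy : 0 < y) :
    Tendsto (fun N : ℕ => logDeriv Real.Gamma (x + N) - logDeriv Real.Gamma (y + N))
      atTop (𝓝 0) := by
  obtain ⟨m, hm⟩ := exists_logDeriv_Gamma_sub_le hx hy
  obtain ⟨k, hk⟩ := exists_logDeriv_Gamma_sub_le hy hx
  refine tendsto_of_tendsto_of_tendsto_of_le_of_le (g := fun N : ℕ => -((k : ℝ) / (x + N)))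
    (by simpa using (tendsto_const_div_add_nat k x).neg) (tendsto_const_div_add_nat m y)
    (fun N => ?_) hm
  have := hk N
  simp only
  linarith

theorem summable_inv_add_nat_sq (a : ℝ) : Summable fun n : ℕ => 1 / (a + n) ^ 2 := by
  have h := (Real.summable_one_div_nat_add_rpow a 2).mpr one_lt_two
  refine h.congr fun n => ?_
  rw [Real.rpow_two, sq_abs, add_comm]

theorem hasDerivAt_logDeriv_Gamma_summand {y : ℝ} (hy : 0 < y) (n : ℕ) :
    HasDerivAt (fun y : ℝ => 1 / (1 + (n : ℝ)) - 1 / (y + n)) (1 / (y + n) ^ 2) y := by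
  have hne : y + n ≠ 0 := by positivity
  have h := (((hasDerivAt_id y).add_const (n : ℝ)).inv hne).const_sub (1 / (1 + (n : ℝ)))
  simp only [one_div] at h ⊢
  convert! h using 1
  simp only [id]
  field_simp

/-- The recurrence telescopes the partial sums to `ψ(y) - ψ(1)` plus `ψ(1 + N) - ψ(y + N)`, and the
latter tends to `0`. -/
theorem logDeriv_Gamma_eq_tsum {y : ℝ} (hy : 0 < y)
    (hs : Summable fun n : ℕ => 1 / (1 + (n : ℝ)) - 1 / (y + n)) :
    logDeriv Real.Gamma y =
      (∑' n : ℕ, (1 / (1 + (n : ℝ)) - 1 / (y + n))) + logDeriv Real.Gamma 1 := by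
  have h2 : Tendsto (fun N : ℕ => ∑ n ∈ Finset.range N, (1 / (1 + (n : ℝ)) - 1 / (y + n)))
      atTop (𝓝 (logDeriv Real.Gamma y - logDeriv Real.Gamma 1)) := by
    have h3 := (tendsto_logDeriv_Gamma_sub one_pos hy).add_const
      (logDeriv Real.Gamma y - logDeriv Real.Gamma 1)
    rw [zero_add] at h3
    refine h3.congr fun N => ?_
    rw [logDeriv_Gamma_add_nat one_pos, logDeriv_Gamma_add_nat hy, Finset.sum_sub_distrib]
    ring
  rw [tendsto_nhds_unique hs.hasSum.tendsto_sum_nat h2, sub_add_cancel]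

theorem hasDerivAt_logDeriv_Gamma {x : ℝ} (hx : 0 < x) :
    HasDerivAt (logDeriv Real.Gamma) (∑' n : ℕ, 1 / (x + n) ^ 2) x := by
  -- `(δ, ∞)` must contain both `x` and the base point `1`, where every summand vanishes; on it the
  -- derivatives are dominated by `1 / (δ + n)²`.
  obtain ⟨δ, hδ0, hδ⟩ := exists_between (lt_min hx one_pos)
  obtain ⟨hδx, hδ1⟩ := lt_min_iff.mp hδ
  have hu := summable_inv_add_nat_sq δ
  have hg : ∀ (n : ℕ), ∀ y ∈ Set.Ioi δ,
      HasDerivAt (fun y : ℝ => 1 / (1 + (n : ℝ)) - 1 / (y + n)) (1 / (y + n) ^ 2) y :=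
    fun n y hy => hasDerivAt_logDeriv_Gamma_summand (hδ0.trans hy) n
  have hg' : ∀ (n : ℕ), ∀ y ∈ Set.Ioi δ, ‖1 / (y + n) ^ 2‖ ≤ 1 / (δ + n) ^ 2 := by
    intro n y hy
    have hy' : δ < y := hy
    have hy0 : 0 < y := hδ0.trans hy'
    rw [Real.norm_of_nonneg (by positivity)]
    gcongr
  have hs0 : Summable fun n : ℕ => 1 / (1 + (n : ℝ)) - 1 / (1 + (n : ℝ)) := by
    simp only [sub_self]
    exact summable_zero
  have hd := hasDerivAt_tsum_of_isPreconnected hu isOpen_Ioi isPreconnected_Ioi hg hg'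
    (y₀ := 1) (Set.mem_Ioi.mpr hδ1) hs0 (Set.mem_Ioi.mpr hδx)
  refine (hd.add_const (logDeriv Real.Gamma 1)).congr_of_eventuallyEq ?_
  filter_upwards [Ioi_mem_nhds hδx] with y hy
  have hs := summable_of_summable_hasDerivAt_of_isPreconnected hu isOpen_Ioi isPreconnected_Ioi
    hg hg' (y₀ := 1) (Set.mem_Ioi.mpr hδ1) hs0 hy
  exact logDeriv_Gamma_eq_tsum (hδ0.trans hy) hs

/-- The trigamma series `∑ 1 / (x + n) ^ 2`. -/
noncomputable def trigammaSeries (x : ℝ) : ℝ := ∑' n : ℕ, 1 / (x + n) ^ 2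

theorem polygamma_one_ofReal {x : ℝ} (hx : 0 < x) :
    polygamma 1 x = (trigammaSeries x : ℂ) := by
  have h1 := (hasDerivAt_polygamma 0 (z := x) (by simpa using hx)).comp_ofReal
  refine h1.unique ((hasDerivAt_logDeriv_Gamma hx).ofReal_comp.congr_of_eventuallyEq ?_)
  filter_upwards [Ioi_mem_nhds hx] with y hy
  simpa [polygamma] using digamma_ofReal hy

theorem trigammaSeries_add_one (x : ℝ) :
    trigammaSeries x = 1 / x ^ 2 + trigammaSeries (x + 1) := by
  rw [trigammaSeries, (summable_inv_add_nat_sq x).tsum_eq_zero_add, trigammaSeries]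
  simp only [Nat.cast_zero, add_zero, Nat.cast_add, Nat.cast_one]
  congr 1
  refine tsum_congr fun n => ?_
  rw [add_right_comm, add_assoc]

/-- Splits the series into even and odd indices. -/
theorem trigammaSeries_two_mul {x : ℝ} (hx : 0 < x) :
    trigammaSeries (2 * x) = (trigammaSeries x + trigammaSeries (x + 1 / 2)) / 4 := by
  have e1 : ∀ k : ℕ, 1 / (2 * x + ((2 * k : ℕ) : ℝ)) ^ 2 = (1 / 4) * (1 / (x + k) ^ 2) := by
    intro k
    have : x + k ≠ 0 := by positivity
    push_cast
    rw [← mul_add]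
    field_simp
    norm_num
  have e2 : ∀ k : ℕ, 1 / (2 * x + ((2 * k + 1 : ℕ) : ℝ)) ^ 2 =
      (1 / 4) * (1 / (x + 1 / 2 + k) ^ 2) := by
    intro k
    have h2 : x + 1 / 2 + k ≠ 0 := by positivity
    push_cast
    rw [show 2 * x + (2 * (k : ℝ) + 1) = 2 * (x + 1 / 2 + k) by ring, mul_pow]
    field_simp
    norm_num
  have s1 := (summable_inv_add_nat_sq x).mul_left (1 / 4)
  have s2 := (summable_inv_add_nat_sq (x + 1 / 2)).mul_left (1 / 4)
  rw [trigammaSeries, ← tsum_even_add_odd (f := fun n : ℕ => 1 / (2 * x + (n : ℝ)) ^ 2)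
    (by simpa only [e1] using s1) (by simpa only [e2] using s2)]
  simp only [e1, e2, tsum_mul_left, trigammaSeries]
  ring

/-! ### Integrals against `1 / (x² + a²)^j` and their derivative in `a`. -/

open MeasureTheory in
theorem integrableOn_div_sq_add_sq_pow {g : ℝ → ℝ} (hg : Measurable g) {C : ℝ}
    (hC : ∀ x, 0 < x → |g x| ≤ C) {a : ℝ} (ha : 0 < a) {j : ℕ} (hj : 1 ≤ j) :
    IntegrableOn (fun x => g x / (x ^ 2 + a ^ 2) ^ j) (Set.Ioi 0) := by
  have hC0 : 0 ≤ C := (abs_nonneg _).trans (hC 1 one_pos)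
  -- This `m` gives `m (1 + x²) ≤ x² + a²`, so the integrable `1 / (1 + x²)` dominates for every `a`
  -- and `j`.
  set m : ℝ := min 1 (a ^ 2) with hm
  have hm0 : 0 < m := by positivity
  have hi : IntegrableOn (fun x : ℝ => C / m ^ j * (1 + x ^ 2)⁻¹) (Set.Ioi 0) :=
    (integrable_inv_one_add_sq.const_mul _).integrableOn
  refine Integrable.mono' hi (Measurable.aestronglyMeasurable (by fun_prop)) ?_
  filter_upwards [ae_restrict_mem measurableSet_Ioi] with x hx
  have hx0 : 0 < x := hx
  have h1 : m * (1 + x ^ 2) ≤ x ^ 2 + a ^ 2 := by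
    nlinarith [min_le_left 1 (a ^ 2), min_le_right 1 (a ^ 2), sq_nonneg x]
  have h2 : m ^ j * (1 + x ^ 2) ≤ (x ^ 2 + a ^ 2) ^ j := by
    calc m ^ j * (1 + x ^ 2) ≤ m ^ j * (1 + x ^ 2) ^ j := by
          gcongr
          exact le_self_pow₀ (by nlinarith [sq_nonneg x]) (by omega)
      _ = (m * (1 + x ^ 2)) ^ j := (mul_pow _ _ _).symm
      _ ≤ _ := by gcongr
  rw [Real.norm_eq_abs, abs_div, abs_of_pos (a := (x ^ 2 + a ^ 2) ^ j) (by positivity)]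
  calc |g x| / (x ^ 2 + a ^ 2) ^ j ≤ C / (m ^ j * (1 + x ^ 2)) := by
        gcongr
        exact hC x hx0
    _ = C / m ^ j * (1 + x ^ 2)⁻¹ := by
        field_simp

/-- The integral of `g x / (x ^ 2 + a ^ 2) ^ j` over `(0, ∞)`. -/
noncomputable def quadraticTransform (g : ℝ → ℝ) (j : ℕ) (a : ℝ) : ℝ :=
  ∫ x in Set.Ioi (0 : ℝ), g x / (x ^ 2 + a ^ 2) ^ j

theorem hasDerivAt_inv_sq_add_sq_pow (c x : ℝ) {a : ℝ} (ha : 0 < a) (j : ℕ) :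
    HasDerivAt (fun a => c / (x ^ 2 + a ^ 2) ^ j)
      (-(2 * j * a) * (c / (x ^ 2 + a ^ 2) ^ (j + 1))) a := by
  have hne : x ^ 2 + a ^ 2 ≠ 0 := by positivity
  have h := ((((hasDerivAt_pow 2 a).const_add (x ^ 2)).pow j).inv (pow_ne_zero j hne)).const_mul c
  convert! h using 1
  rcases j with _ | j
  · simp
  · push_cast
    simp only [Pi.pow_apply]
    field_simp
    ring

open MeasureTheory in
theorem hasDerivAt_quadraticTransform {g : ℝ → ℝ} (hg : Measurable g) {C : ℝ}
    (hC : ∀ x, 0 < x → |g x| ≤ C) {a : ℝ} (ha : 0 < a) {j : ℕ} (hj : 1 ≤ j) :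
    HasDerivAt (quadraticTransform g j) (-(2 * j * a) * quadraticTransform g (j + 1) a) a := by
  have hC0 : 0 ≤ C := (abs_nonneg _).trans (hC 1 one_pos)
  -- Dominating function for `a/2 < y < 2a`: the prefactor is largest at `2a`, the denominator
  -- smallest at `a/2`.
  have hb : IntegrableOn (fun x : ℝ => 2 * j * (2 * a) * (C / (x ^ 2 + (a / 2) ^ 2) ^ (j + 1)))
      (Set.Ioi 0) :=
    (integrableOn_div_sq_add_sq_pow (g := fun _ => C) measurable_const
      (fun x _ => (abs_of_nonneg hC0).le) (half_pos ha) (by omega)).const_mul _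
  have h := hasDerivAt_integral_of_dominated_loc_of_deriv_le
    (μ := volume.restrict (Set.Ioi (0 : ℝ))) (x₀ := a) (s := Set.Ioo (a / 2) (2 * a))
    (F := fun a x => g x / (x ^ 2 + a ^ 2) ^ j)
    (F' := fun a x => -(2 * j * a) * (g x / (x ^ 2 + a ^ 2) ^ (j + 1)))
    (Ioo_mem_nhds (by linarith) (by linarith))
    (Eventually.of_forall fun y => Measurable.aestronglyMeasurable (by fun_prop))
    (integrableOn_div_sq_add_sq_pow hg hC ha hj)
    (Measurable.aestronglyMeasurable (by fun_prop)) ?_ hb ?_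
  · have h2 := h.2
    rwa [integral_const_mul] at h2
  · filter_upwards [ae_restrict_mem measurableSet_Ioi] with x hx y hy
    have hx0 : 0 < x := hx
    have hy0 : 0 < y := (half_pos ha).trans hy.1
    rw [norm_mul, norm_neg, Real.norm_of_nonneg (by positivity), Real.norm_eq_abs, abs_div,
      abs_of_pos (a := (x ^ 2 + y ^ 2) ^ (j + 1)) (by positivity)]
    have h1 := hC x hx0
    have h2 := hy.1
    have h3 := hy.2
    gcongr
  · filter_upwards with x y hy
    exact hasDerivAt_inv_sq_add_sq_pow _ _ ((half_pos ha).trans hy.1) j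

/-! ### Explicit rational integrals. -/

theorem quadraticTransform_one_one {a : ℝ} (ha : 0 < a) :
    quadraticTransform (fun _ => 1) 1 a = Real.pi / (2 * a) := by
  have h := MeasureTheory.integral_comp_mul_left_Ioi (fun x : ℝ => (1 + x ^ 2)⁻¹) 0
    (inv_pos.mpr ha)
  rw [mul_zero, integral_Ioi_inv_one_add_sq, Real.arctan_zero, sub_zero, inv_inv] at h
  have e : ∀ x : ℝ, 1 / (x ^ 2 + a ^ 2) ^ 1 = (a ^ 2)⁻¹ * (1 + (a⁻¹ * x) ^ 2)⁻¹ := by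
    intro x
    have : x ^ 2 + a ^ 2 ≠ 0 := by positivity
    field_simp
    ring
  simp only [quadraticTransform, e]
  rw [MeasureTheory.integral_const_mul, h]
  simp only [smul_eq_mul]
  field_simp

theorem quadraticTransform_succ_eq {g : ℝ → ℝ} (hg : Measurable g) {C : ℝ}
    (hC : ∀ x, 0 < x → |g x| ≤ C) {j : ℕ} (hj : 1 ≤ j) {f : ℝ → ℝ} {f' a : ℝ} (ha : 0 < a)
    (hf : ∀ a, 0 < a → quadraticTransform g j a = f a) (hf' : HasDerivAt f f' a) :
    quadraticTransform g (j + 1) a = -f' / (2 * j * a) := by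
  have h := (hasDerivAt_quadraticTransform hg hC ha hj).congr_of_eventuallyEq (f₁ := f) (by
    filter_upwards [Ioi_mem_nhds ha] with y hy using (hf y hy).symm)
  have hj0 : (0 : ℝ) < j := by exact_mod_cast hj
  rw [hf'.unique h]
  field_simp

theorem quadraticTransform_one_two {a : ℝ} (ha : 0 < a) :
    quadraticTransform (fun _ => 1) 2 a = Real.pi / (4 * a ^ 3) := by
  have h : HasDerivAt (fun a => Real.pi / (2 * a)) (-Real.pi / (2 * a ^ 2)) a := by
    have h := ((((hasDerivAt_id a).const_mul 2).inv (by simpa using ha.ne')).const_mul Real.pi)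
    convert! h using 1
    simp only [id]
    field_simp
  rw [quadraticTransform_succ_eq (j := 1) measurable_const (C := 1) (by simp) le_rfl ha
    (fun a ha => quadraticTransform_one_one ha) h]
  push_cast
  field_simp
  norm_num

theorem quadraticTransform_one_three {a : ℝ} (ha : 0 < a) :
    quadraticTransform (fun _ => 1) 3 a = 3 * Real.pi / (16 * a ^ 5) := by
  have h : HasDerivAt (fun a => Real.pi / (4 * a ^ 3)) (-(3 * Real.pi) / (4 * a ^ 4)) a := by
    have h := ((((hasDerivAt_pow 3 a).const_mul 4).inv (by positivity)).const_mul Real.pi)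
    convert! h using 1
    push_cast
    field_simp
  rw [quadraticTransform_succ_eq (j := 2) measurable_const (C := 1) (by simp) one_le_two ha
    (fun a ha => quadraticTransform_one_two ha) h]
  push_cast
  field_simp
  norm_num

/-- Here `g(x) = x` is unbounded, so the lemmas for bounded `g` do not apply; an explicit
antiderivative is used. -/
theorem quadraticTransform_id_two {a : ℝ} (ha : 0 < a) :
    MeasureTheory.IntegrableOn (fun x => x / (x ^ 2 + a ^ 2) ^ 2) (Set.Ioi 0) ∧
    ∫ x in Set.Ioi (0 : ℝ), x / (x ^ 2 + a ^ 2) ^ 2 = 1 / (2 * a ^ 2) := by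
  have hd : ∀ x : ℝ, HasDerivAt (fun x => -(1 / 2) * (x ^ 2 + a ^ 2)⁻¹)
      (x / (x ^ 2 + a ^ 2) ^ 2) x := by
    intro x
    have hne : x ^ 2 + a ^ 2 ≠ 0 := by positivity
    have h := (((hasDerivAt_pow 2 x).add_const (a ^ 2)).inv hne).const_mul (-(1 / 2))
    convert! h using 1
    push_cast
    field_simp
  have ht : Tendsto (fun x : ℝ => -(1 / 2) * (x ^ 2 + a ^ 2)⁻¹) atTop (𝓝 0) := by
    have h : Tendsto (fun x : ℝ => x ^ 2 + a ^ 2) atTop atTop :=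
      tendsto_atTop_add_const_right _ _ (tendsto_pow_atTop two_ne_zero)
    have h2 := h.inv_tendsto_atTop.const_mul (-(1 / 2) : ℝ)
    rwa [mul_zero] at h2
  have hc : ContinuousWithinAt (fun x : ℝ => -(1 / 2) * (x ^ 2 + a ^ 2)⁻¹) (Set.Ici 0) 0 :=
    (hd 0).continuousAt.continuousWithinAt
  have hi := MeasureTheory.integrableOn_Ioi_deriv_of_nonneg hc (fun x _ => hd x)
    (fun x hx => div_nonneg (le_of_lt hx) (by positivity)) ht
  refine ⟨hi, ?_⟩
  rw [MeasureTheory.integral_Ioi_of_hasDerivAt_of_tendsto hc (fun x _ => hd x) hi ht]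
  field_simp
  norm_num

theorem abs_two_mul_sq_div_le {c : ℝ} (hc : 0 < c) (x : ℝ) :
    |2 * x ^ 2 / (x ^ 2 + c ^ 2)| ≤ 2 := by
  rw [abs_of_nonneg (by positivity), div_le_iff₀ (by positivity)]
  nlinarith [sq_nonneg c]

theorem quadraticTransform_rational {a c : ℝ} (ha : 0 < a) (hc : 0 < c) :
    quadraticTransform (fun x => 2 * x ^ 2 / (x ^ 2 + c ^ 2)) 2 a =
      Real.pi / (2 * a * (a + c) ^ 2) := by
  have hI : ∀ {a : ℝ}, 0 < a → ∀ {j : ℕ}, 1 ≤ j → MeasureTheory.IntegrableOn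
      (fun x : ℝ => 1 / (x ^ 2 + a ^ 2) ^ j) (Set.Ioi 0) := fun ha _ hj =>
    integrableOn_div_sq_add_sq_pow measurable_const (C := 1) (by simp) ha hj
  -- The partial fractions of the second case have `a² - c²` in the denominator. Equality does occur
  -- in the application, when `a` is a multiple of `2π`.
  rcases eq_or_ne a c with rfl | hne
  · have e : ∀ x : ℝ, 2 * x ^ 2 / (x ^ 2 + a ^ 2) / (x ^ 2 + a ^ 2) ^ 2 =
        2 * (1 / (x ^ 2 + a ^ 2) ^ 2) - 2 * a ^ 2 * (1 / (x ^ 2 + a ^ 2) ^ 3) := by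
      intro x
      have : x ^ 2 + a ^ 2 ≠ 0 := by positivity
      field_simp
      ring
    simp only [quadraticTransform, e]
    rw [MeasureTheory.integral_sub ((hI ha (by norm_num)).const_mul _)
      ((hI ha (by norm_num)).const_mul _), MeasureTheory.integral_const_mul,
      MeasureTheory.integral_const_mul]
    have h2 := quadraticTransform_one_two ha
    have h3 := quadraticTransform_one_three ha
    simp only [quadraticTransform] at h2 h3
    rw [h2, h3]
    field_simp
    norm_num
  · have hs : a ^ 2 - c ^ 2 ≠ 0 := by
      rw [sq_sub_sq]
      exact mul_ne_zero (by positivity) (sub_ne_zero.mpr hne)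
    set A : ℝ := 2 * c ^ 2 / (a ^ 2 - c ^ 2) ^ 2 with hA
    set B : ℝ := 2 * a ^ 2 / (a ^ 2 - c ^ 2) with hB
    have e : ∀ x : ℝ, 2 * x ^ 2 / (x ^ 2 + c ^ 2) / (x ^ 2 + a ^ 2) ^ 2 =
        A * (1 / (x ^ 2 + a ^ 2) ^ 1) + B * (1 / (x ^ 2 + a ^ 2) ^ 2) -
          A * (1 / (x ^ 2 + c ^ 2) ^ 1) := by
      intro x
      have h1 : x ^ 2 + a ^ 2 ≠ 0 := by positivity
      have h2 : x ^ 2 + c ^ 2 ≠ 0 := by positivity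
      rw [hA, hB]
      field_simp
      ring
    simp only [quadraticTransform, e]
    rw [MeasureTheory.integral_sub, MeasureTheory.integral_add]
    rotate_left
    · exact (hI ha (by norm_num)).const_mul _
    · exact (hI ha (by norm_num)).const_mul _
    · exact ((hI ha (by norm_num)).const_mul _).add ((hI ha (by norm_num)).const_mul _)
    · exact (hI hc (by norm_num)).const_mul _
    rw [MeasureTheory.integral_const_mul,
      MeasureTheory.integral_const_mul, MeasureTheory.integral_const_mul]
    have h1 := quadraticTransform_one_one ha
    have h2 := quadraticTransform_one_two ha
    have h3 := quadraticTransform_one_one hc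
    simp only [quadraticTransform] at h1 h2 h3
    rw [h1, h2, h3, hA, hB]
    have hp : a + c ≠ 0 := by positivity
    field_simp
    ring

/-! ### Partial fractions of `y / (e^y - 1)`. -/

theorem tsum_pnat_eq_tsum_nat_add_one (f : ℕ → ℂ) : ∑' n : ℕ+, f n = ∑' n : ℕ, f (n + 1) :=
  tsum_pnat_eq_tsum_succ (f := f)

theorem cot_term_mul_I {r : ℝ} (hr : 0 < r) (n : ℕ) :
    1 / (-(r : ℂ) * Complex.I - ((n + 1 : ℕ) : ℂ)) + 1 / (-(r : ℂ) * Complex.I + ((n + 1 : ℕ) : ℂ)) =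
      Complex.I * ((2 * r / (r ^ 2 + (n + 1) ^ 2) : ℝ) : ℂ) := by
  have h : ∀ s : ℝ, -(r : ℂ) * Complex.I + (s : ℂ) ≠ 0 := by
    intro s hs
    have := congrArg Complex.im hs
    simp at this
    exact hr.ne' this
  have h1 := h (-((n : ℝ) + 1))
  have h2 := h ((n : ℝ) + 1)
  have h3 : (r : ℂ) ^ 2 + ((n : ℂ) + 1) ^ 2 ≠ 0 := by
    have : r ^ 2 + ((n : ℝ) + 1) ^ 2 ≠ 0 := by positivity
    exact_mod_cast this
  push_cast at h1 h2 ⊢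
  rw [← sub_eq_add_neg] at h1
  rw [div_add_div _ _ h1 h2, mul_div_assoc', div_eq_div_iff (mul_ne_zero h1 h2) h3]
  linear_combination (-2 * Complex.I * r ^ 3) * Complex.I_sq

/-- The Mittag-Leffler series of `π cot(πz)` at `z = -iy/(2π)`, where `e^(2πiz) = e^y`. -/
theorem div_exp_sub_one_eq_tsum {y : ℝ} (hy : 0 < y) :
    y / (Real.exp y - 1) =
      1 - y / 2 + ∑' n : ℕ, 2 * y ^ 2 / (y ^ 2 + (2 * Real.pi * (n + 1)) ^ 2) := by
  obtain ⟨r, hr⟩ : ∃ r : ℝ, r = y / (2 * Real.pi) := ⟨_, rfl⟩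
  have hr0 : 0 < r := by rw [hr]; positivity
  have hyr : y = 2 * Real.pi * r := by rw [hr]; field_simp
  have hE : Real.exp y - 1 ≠ 0 := by
    have := Real.one_lt_exp_iff.mpr hy
    linarith
  have hEc' : 1 - Complex.exp y ≠ 0 := by
    rw [← neg_sub]
    exact neg_ne_zero.mpr (by exact_mod_cast hE)
  have hmem : -(r : ℂ) * Complex.I ∈ Complex.integerComplement := by
    rw [Complex.mem_integerComplement_iff]
    rintro ⟨n, hn⟩
    have := congrArg Complex.im hn
    simp at this
    exact hr0.ne' this
  have h := cot_series_rep hmem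
  rw [tsum_pnat_eq_tsum_nat_add_one (fun n : ℕ =>
      1 / (-(r : ℂ) * Complex.I - (n : ℂ)) + 1 / (-(r : ℂ) * Complex.I + (n : ℂ)))] at h
  simp only [cot_term_mul_I hr0] at h
  rw [tsum_mul_left, ← Complex.ofReal_tsum, Complex.cot_eq_exp_ratio] at h
  have e1 : 2 * Complex.I * (Real.pi * (-(r : ℂ) * Complex.I)) = (y : ℂ) := by
    rw [hyr]
    push_cast
    linear_combination (-2 * (Real.pi : ℂ) * r) * Complex.I_sq
  rw [e1] at h
  set S : ℝ := ∑' n : ℕ, 2 * r / (r ^ 2 + (n + 1) ^ 2) with hS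
  have hr0c : (r : ℂ) ≠ 0 := by exact_mod_cast hr0.ne'
  have h' : (Real.pi : ℂ) * (Complex.exp y + 1) * r = (Complex.exp y - 1) * (1 + r * S) := by
    field_simp at h
    linear_combination h + (r * S * (1 - Complex.exp y)) * Complex.I_sq
  have h'' : Real.pi * (Real.exp y + 1) * r = (Real.exp y - 1) * (1 + r * S) := by
    exact_mod_cast h'
  have e2 : ∑' n : ℕ, 2 * y ^ 2 / (y ^ 2 + (2 * Real.pi * (n + 1)) ^ 2) = r * S := by
    rw [hS, ← tsum_mul_left]
    refine tsum_congr fun n => ?_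
    rw [hyr]
    field_simp
  rw [e2, div_eq_iff hE, hyr]
  rw [hyr] at h''
  linear_combination h''

/-! ### Convergence, scaling and differentiation of the two families of integrals. -/

theorem measurable_div_exp_add (c μ : ℝ) : Measurable fun x : ℝ => x / (Real.exp (μ * x) + c) := by
  fun_prop

theorem abs_div_exp_sub_one_le {μ x : ℝ} (hμ : 0 < μ) (hx : 0 < x) :
    |x / (Real.exp (μ * x) - 1)| ≤ 1 / μ := by
  have h := Real.add_one_le_exp (μ * x)
  have h2 : 0 < μ * x := by positivity
  rw [abs_of_nonneg (div_nonneg hx.le (by linarith)), div_le_div_iff₀ (by linarith) hμ]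
  linarith

theorem abs_div_exp_add_one_le {μ x : ℝ} (hμ : 0 < μ) (hx : 0 < x) :
    |x / (Real.exp (μ * x) + 1)| ≤ 1 / μ := by
  have h := Real.add_one_le_exp (μ * x)
  have h2 : 0 < μ * x := by positivity
  rw [abs_of_nonneg (by positivity), div_le_div_iff₀ (by linarith) hμ]
  linarith

theorem kernelPlus_one (j : ℕ) (b μ x : ℝ) :
    kernelPlus 1 j 1 b μ x = x / (Real.exp (μ * x) + 1) / (x ^ 2 + b ^ 2) ^ j := by
  rw [kernelPlus, pow_one, pow_one, div_div, mul_comm]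

theorem kernelMinus_one (j : ℕ) (b μ x : ℝ) :
    kernelMinus 1 j 1 b μ x = x / (Real.exp (μ * x) - 1) / (x ^ 2 + b ^ 2) ^ j := by
  rw [kernelMinus, pow_one, pow_one, div_div, mul_comm]

theorem integrableOn_kernelPlus {j : ℕ} (hj : 1 ≤ j) {b μ : ℝ} (hb : 0 < b) (hμ : 0 < μ) :
    MeasureTheory.IntegrableOn (kernelPlus 1 j 1 b μ) (Set.Ioi 0) := by
  rw [funext (kernelPlus_one j b μ)]
  exact integrableOn_div_sq_add_sq_pow (measurable_div_exp_add 1 μ)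
    (fun x hx => abs_div_exp_add_one_le hμ hx) hb hj

theorem integrableOn_kernelMinus {j : ℕ} (hj : 1 ≤ j) {b μ : ℝ} (hb : 0 < b) (hμ : 0 < μ) :
    MeasureTheory.IntegrableOn (kernelMinus 1 j 1 b μ) (Set.Ioi 0) := by
  rw [funext (kernelMinus_one j b μ)]
  exact integrableOn_div_sq_add_sq_pow (measurable_div_exp_add (-1) μ)
    (fun x hx => abs_div_exp_sub_one_le hμ hx) hb hj

theorem quadraticTransform_comp_mul (h : ℝ → ℝ) {j : ℕ} (hj : 1 ≤ j) (b : ℝ) {μ : ℝ}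
    (hμ : 0 < μ) :
    quadraticTransform (fun x => x / h (μ * x)) j b =
      μ ^ (2 * j - 2) * quadraticTransform (fun x => x / h x) j (b * μ) := by
  have hs := MeasureTheory.integral_comp_mul_left_Ioi
    (fun x : ℝ => x / h x / (x ^ 2 + (b * μ) ^ 2) ^ j) 0 hμ
  rw [mul_zero, smul_eq_mul] at hs
  have e : ∀ x : ℝ, x / h (μ * x) / (x ^ 2 + b ^ 2) ^ j =
      μ ^ (2 * j - 1) * (μ * x / h (μ * x) / ((μ * x) ^ 2 + (b * μ) ^ 2) ^ j) := by
    intro x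
    have e2 : (μ * x) ^ 2 + (b * μ) ^ 2 = μ ^ 2 * (x ^ 2 + b ^ 2) := by ring
    have e3 : (μ ^ 2) ^ j = μ ^ (2 * j - 1) * μ := by
      rw [← pow_mul, ← pow_succ]
      congr 1
      omega
    rw [e2, mul_pow, e3]
    field_simp
  simp only [quadraticTransform, e]
  rw [MeasureTheory.integral_const_mul, hs]
  have e4 : μ ^ (2 * j - 1) = μ ^ (2 * j - 2) * μ := by
    rw [← pow_succ]
    congr 1
    omega
  rw [e4]
  field_simp

theorem assocPlus_eq (j : ℕ) (b μ : ℝ) :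
    assocPlus 1 j 1 b μ = quadraticTransform (fun x => x / (Real.exp (μ * x) + 1)) j b := by
  simp only [assocPlus, kernelPlus_one, quadraticTransform]

theorem assocMinus_eq (j : ℕ) (b μ : ℝ) :
    assocMinus 1 j 1 b μ = quadraticTransform (fun x => x / (Real.exp (μ * x) - 1)) j b := by
  simp only [assocMinus, kernelMinus_one, quadraticTransform]

theorem hatPlus_eq (j : ℕ) (b : ℝ) :
    hatPlus 1 j 1 b = quadraticTransform (fun x => x / (Real.exp x + 1)) j b := by
  simp only [hatPlus, assocPlus_eq, one_mul]

theorem hatMinus_eq (j : ℕ) (b : ℝ) :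
    hatMinus 1 j 1 b = quadraticTransform (fun x => x / (Real.exp x - 1)) j b := by
  simp only [hatMinus, assocMinus_eq, one_mul]

theorem assocPlus_scaling {j : ℕ} (hj : 1 ≤ j) (b : ℝ) {μ : ℝ} (hμ : 0 < μ) :
    assocPlus 1 j 1 b μ = μ ^ (2 * j - 2) * hatPlus 1 j 1 (b * μ) := by
  rw [assocPlus_eq, hatPlus_eq]
  exact quadraticTransform_comp_mul (fun x => Real.exp x + 1) hj b hμ

theorem assocMinus_scaling {j : ℕ} (hj : 1 ≤ j) (b : ℝ) {μ : ℝ} (hμ : 0 < μ) :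
    assocMinus 1 j 1 b μ = μ ^ (2 * j - 2) * hatMinus 1 j 1 (b * μ) := by
  rw [assocMinus_eq, hatMinus_eq]
  exact quadraticTransform_comp_mul (fun x => Real.exp x - 1) hj b hμ

theorem hasDerivAt_hatPlus {j : ℕ} (hj : 1 ≤ j) {a : ℝ} (ha : 0 < a) :
    HasDerivAt (hatPlus 1 j 1) (-(2 * j * a) * hatPlus 1 (j + 1) 1 a) a := by
  rw [funext (hatPlus_eq j), hatPlus_eq]
  exact hasDerivAt_quadraticTransform (by simpa using measurable_div_exp_add 1 1) (C := 1)
    (fun x hx => by simpa using abs_div_exp_add_one_le one_pos hx) ha hj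

theorem hasDerivAt_hatMinus {j : ℕ} (hj : 1 ≤ j) {a : ℝ} (ha : 0 < a) :
    HasDerivAt (hatMinus 1 j 1) (-(2 * j * a) * hatMinus 1 (j + 1) 1 a) a := by
  rw [funext (hatMinus_eq j), hatMinus_eq]
  exact hasDerivAt_quadraticTransform
    (by simpa [sub_eq_add_neg] using measurable_div_exp_add (-1) 1) (C := 1)
    (fun x hx => by simpa using abs_div_exp_sub_one_le one_pos hx) ha hj

/-! ### Closed forms for `j = 2`. -/

theorem tsum_quadraticTransform_rational {a : ℝ} (ha : 0 < a) :
    HasSum (fun n : ℕ => Real.pi / (2 * a * (a + 2 * Real.pi * (n + 1)) ^ 2))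
      (trigammaSeries (a / (2 * Real.pi) + 1) / (8 * Real.pi * a)) := by
  have h := (summable_inv_add_nat_sq (a / (2 * Real.pi) + 1)).hasSum.div_const (8 * Real.pi * a)
  convert! h using 2 with n
  have h1 : a + 2 * Real.pi * (n + 1) = 2 * Real.pi * (a / (2 * Real.pi) + 1 + n) := by
    field_simp
    ring
  rw [h1]
  field_simp
  norm_num

-- The summands of the partial fraction series are nonnegative, so summability of their integrals
-- justifies termwise integration; the terms `1` and `-y/2` supply the elementary part.
open MeasureTheory in
theorem hatMinus_two {a : ℝ} (ha : 0 < a) :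
    hatMinus 1 2 1 a = -(Real.pi / (4 * a ^ 3)) - 1 / (4 * a ^ 2) +
      trigammaSeries (a / (2 * Real.pi)) / (8 * Real.pi * a) := by
  have hc : ∀ n : ℕ, 0 < 2 * Real.pi * ((n : ℝ) + 1) := fun n => by positivity
  have hI : ∀ n : ℕ, IntegrableOn (fun x : ℝ =>
      2 * x ^ 2 / (x ^ 2 + (2 * Real.pi * ((n : ℝ) + 1)) ^ 2) / (x ^ 2 + a ^ 2) ^ 2) (Set.Ioi 0) :=
    fun n => integrableOn_div_sq_add_sq_pow (by fun_prop)
      (fun x _ => abs_two_mul_sq_div_le (hc n) x) ha (by norm_num)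
  have hval := fun n : ℕ => quadraticTransform_rational ha (hc n)
  simp only [quadraticTransform] at hval
  have hsum := tsum_quadraticTransform_rational ha
  have hnorm : ∀ (n : ℕ) (x : ℝ),
      ‖2 * x ^ 2 / (x ^ 2 + (2 * Real.pi * ((n : ℝ) + 1)) ^ 2) / (x ^ 2 + a ^ 2) ^ 2‖ =
        2 * x ^ 2 / (x ^ 2 + (2 * Real.pi * ((n : ℝ) + 1)) ^ 2) / (x ^ 2 + a ^ 2) ^ 2 :=
    fun n x => Real.norm_of_nonneg (by positivity)
  have h := hasSum_integral_of_summable_integral_norm hI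
    (by simp only [hnorm, hval]; exact hsum.summable)
  simp only [hval] at h
  have h1 := h.unique hsum
  have e : Set.EqOn (fun x : ℝ => ∑' n : ℕ,
        2 * x ^ 2 / (x ^ 2 + (2 * Real.pi * ((n : ℝ) + 1)) ^ 2) / (x ^ 2 + a ^ 2) ^ 2)
      (fun x => x / (Real.exp x - 1) / (x ^ 2 + a ^ 2) ^ 2 - 1 / (x ^ 2 + a ^ 2) ^ 2 +
        (1 / 2) * (x / (x ^ 2 + a ^ 2) ^ 2)) (Set.Ioi 0) := by
    intro x hx
    simp only
    rw [tsum_div_const, div_exp_sub_one_eq_tsum hx]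
    ring
  rw [setIntegral_congr_fun measurableSet_Ioi e] at h1
  have hi1 : IntegrableOn (fun x : ℝ => x / (Real.exp x - 1) / (x ^ 2 + a ^ 2) ^ 2)
      (Set.Ioi 0) := by
    have := integrableOn_kernelMinus one_le_two ha one_pos
    simpa only [funext (kernelMinus_one 2 a 1), one_mul] using this
  have hi2 : IntegrableOn (fun x : ℝ => 1 / (x ^ 2 + a ^ 2) ^ 2) (Set.Ioi 0) :=
    integrableOn_div_sq_add_sq_pow measurable_const (C := 1) (by simp) ha one_le_two
  have hi3 := (quadraticTransform_id_two ha).1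
  have hi12 : IntegrableOn (fun x : ℝ => x / (Real.exp x - 1) / (x ^ 2 + a ^ 2) ^ 2 -
      1 / (x ^ 2 + a ^ 2) ^ 2) (Set.Ioi 0) := hi1.sub hi2
  rw [integral_add hi12 (hi3.const_mul _), integral_sub hi1 hi2, integral_const_mul,
    (quadraticTransform_id_two ha).2] at h1
  have h2 := quadraticTransform_one_two ha
  simp only [quadraticTransform] at h2
  rw [h2] at h1
  rw [hatMinus_eq, quadraticTransform, trigammaSeries_add_one]
  -- Moving the trigamma argument from `a/(2π) + 1` to `a/(2π)` costs `π/(2a³)`, which flips the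
  -- sign of `π/(4a³)`.
  have h3 : Real.pi / (4 * a ^ 3) =
      -(Real.pi / (4 * a ^ 3)) + 1 / (a / (2 * Real.pi)) ^ 2 / (8 * Real.pi * a) := by
    field_simp
    norm_num
  have h4 : (1 / 2) * (1 / (2 * a ^ 2)) = 1 / (4 * a ^ 2) := by
    field_simp
    norm_num
  rw [add_div]
  linarith

-- From `1/(e^x + 1) = 1/(e^x - 1) - 2/(e^(2x) - 1)`; the `8` is this `2` times the scaling factor
-- `μ^(2j-2) = 4` at `μ = 2`.
open MeasureTheory in
theorem hatPlus_eq_hatMinus_sub {a : ℝ} (ha : 0 < a) :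
    hatPlus 1 2 1 a = hatMinus 1 2 1 a - 8 * hatMinus 1 2 1 (2 * a) := by
  have h := assocMinus_scaling one_le_two a two_pos
  have i1 := integrableOn_kernelMinus one_le_two ha one_pos
  have i2 := integrableOn_kernelMinus one_le_two ha two_pos
  have e : Set.EqOn (kernelPlus 1 2 1 a 1)
      (fun x => kernelMinus 1 2 1 a 1 x - 2 * kernelMinus 1 2 1 a 2 x) (Set.Ioi 0) := by
    intro x hx
    have hx0 : 0 < x := hx
    simp only [kernelPlus_one, kernelMinus_one, one_mul]
    have hE := Real.one_lt_exp_iff.mpr hx0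
    have h1 : Real.exp x - 1 ≠ 0 := by linarith
    have h2 : Real.exp x + 1 ≠ 0 := by linarith
    have h3 : Real.exp (2 * x) - 1 = (Real.exp x - 1) * (Real.exp x + 1) := by
      rw [two_mul, Real.exp_add]
      ring
    rw [h3]
    field_simp
    ring
  rw [hatPlus, assocPlus, setIntegral_congr_fun measurableSet_Ioi e,
    integral_sub i1 (i2.const_mul 2), integral_const_mul]
  have h4 : ∫ x in Set.Ioi (0 : ℝ), kernelMinus 1 2 1 a 2 x = assocMinus 1 2 1 a 2 := rfl
  rw [h4, h, mul_comm a 2]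
  simp only [hatMinus, assocMinus]
  ring

theorem hatPlus_two {a : ℝ} (ha : 0 < a) :
    hatPlus 1 2 1 a = 1 / (4 * a ^ 2) -
      trigammaSeries (a / (2 * Real.pi) + 1 / 2) / (8 * Real.pi * a) := by
  have h := trigammaSeries_two_mul (x := a / (2 * Real.pi)) (by positivity)
  rw [hatPlus_eq_hatMinus_sub ha, hatMinus_two ha, hatMinus_two (by positivity),
    mul_div_assoc 2 a, h]
  field_simp
  ring

/-! ### Existence of the expansions, by induction on `j`. -/

/-- The polygamma part of the expansions for `j = k + 2`, with shift `s` in the argument. -/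
noncomputable def polygammaSum (c : ℕ → ℝ) (k : ℕ) (s a : ℂ) : ℂ :=
  ∑ i ∈ Finset.range (k + 1), (-1 : ℂ) ^ (i + 1) * (c (i + 1) : ℂ) *
    (1 / (a ^ (2 * k + 1 - i) * (Real.pi : ℂ) ^ (i + 1))) *
    polygamma (i + 1) (a / (2 * Real.pi) + s)

theorem sum_Icc_eq_polygammaSum (c : ℕ → ℝ) (k : ℕ) (s a : ℂ) :
    ∑ i ∈ Finset.Icc 1 (k + 2 - 1), (-1 : ℂ) ^ i * (c i : ℂ) *
      (1 / (a ^ (2 * (k + 2) - i - 2) * (Real.pi : ℂ) ^ i)) *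
      polygamma i (a / (2 * Real.pi) + s) = polygammaSum c k s a := by
  have h : Finset.Icc 1 (k + 2 - 1) = Finset.Ico 1 (k + 2) := by
    ext i
    simp only [Finset.mem_Icc, Finset.mem_Ico]
    omega
  rw [h, Finset.sum_Ico_eq_sum_range, polygammaSum]
  refine Finset.sum_congr (by congr 1) fun i _ => ?_
  rw [add_comm 1 i, show 2 * (k + 2) - (i + 1) - 2 = 2 * k + 1 - i by omega]

theorem isPlusExpansion_iff (k : ℕ) (c : ℕ → ℝ) :
    IsPlusExpansion (k + 2) c ↔ ∀ a : ℝ, 0 < a → (hatPlus 1 (k + 2) 1 a : ℂ) =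
      (c 0 : ℂ) / (a : ℂ) ^ (2 * k + 2) + polygammaSum c k (1 / 2) a := by
  have e : 2 * (k + 2) - 2 = 2 * k + 2 := by omega
  constructor
  · intro h a ha
    have := h a 1 ha one_pos
    rw [sum_Icc_eq_polygammaSum, e] at this
    simpa only [mul_one, Complex.ofReal_one, mul_one_div] using this
  · intro h b μ hb hμ
    have := h (b * μ) (mul_pos hb hμ)
    rw [sum_Icc_eq_polygammaSum, e, mul_one_div, this]
    push_cast
    rfl

theorem isMinusExpansion_iff (k : ℕ) (c : ℤ → ℝ) :
    IsMinusExpansion (k + 2) c ↔ ∀ a : ℝ, 0 < a → (hatMinus 1 (k + 2) 1 a : ℂ) =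
      -((c (-1) : ℂ) * Real.pi / (a : ℂ) ^ (2 * k + 3)) - (c 0 : ℂ) / (a : ℂ) ^ (2 * k + 2) -
        polygammaSum (fun i => c i) k 0 a := by
  have e : 2 * (k + 2) - 2 = 2 * k + 2 := by omega
  have e' : 2 * (k + 2) - 1 = 2 * k + 3 := by omega
  have hs := fun a : ℂ => sum_Icc_eq_polygammaSum (fun i => c i) k 0 a
  simp only [add_zero] at hs
  constructor
  · intro h a ha
    have := h a 1 ha one_pos
    rw [hs, e, e'] at this
    simpa only [mul_one, Complex.ofReal_one, mul_one_div, neg_mul, mul_div_assoc] using this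
  · intro h b μ hb hμ
    have := h (b * μ) (mul_pos hb hμ)
    rw [hs, e, e', mul_one_div, this]
    push_cast
    simp only [neg_mul, mul_div_assoc]

/-- The solution of the recursion, indexed by `k = j - 2`, extended by zero. -/
noncomputable def expansionCoeff : ℕ → ℕ → ℝ
  | 0, 0 => 1 / 4
  | 0, 1 => 1 / 8
  | 0, _ + 2 => 0
  | k + 1, 0 => ((k : ℝ) + 1) / (k + 2) * expansionCoeff k 0
  | k + 1, 1 => (2 * (k : ℝ) + 1) / (2 * k + 4) * expansionCoeff k 1
  | k + 1, i + 2 => (2 * (k : ℝ) - i) / (2 * k + 4) * expansionCoeff k (i + 2) +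
      1 / (4 * ((k : ℝ) + 2)) * expansionCoeff k (i + 1)

/-- Thanks to these zeros the top case `i = j - 1` of the recursion is an instance of the middle
case. -/
theorem expansionCoeff_eq_zero {k i : ℕ} (h : k + 2 ≤ i) : expansionCoeff k i = 0 := by
  induction k generalizing i with
  | zero =>
    obtain ⟨i, rfl⟩ := Nat.exists_eq_add_of_le' h
    rw [expansionCoeff]
  | succ k ih =>
    obtain ⟨i, rfl⟩ := Nat.exists_eq_add_of_le' (show 2 ≤ i by omega)
    rw [expansionCoeff, ih (by omega), ih (by omega), mul_zero, mul_zero, add_zero]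

/-- The coefficient of `π / a ^ (2 j - 1)` in the expansion of `Î⁻`, indexed by `k = j - 2`. -/
noncomputable def leadingCoeffMinus : ℕ → ℝ
  | 0 => 1 / 4
  | k + 1 => (2 * (k : ℝ) + 3) / (2 * k + 4) * leadingCoeffMinus k

theorem hasDerivAt_div_pow (c : ℂ) (n : ℕ) {a : ℂ} (ha : a ≠ 0) :
    HasDerivAt (fun a => c / a ^ n) (-n * c / a ^ (n + 1)) a := by
  have h := ((hasDerivAt_pow n a).inv (pow_ne_zero n ha)).const_mul c
  convert! h using 1
  rcases n with _ | n
  · simp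
  · push_cast
    field_simp
    ring

theorem hasDerivAt_polygammaSum (k : ℕ) {s : ℝ} (hs : 0 ≤ s) {a : ℂ} (ha : 0 < a.re) :
    HasDerivAt (polygammaSum (expansionCoeff k) k s)
      (-(2 * (k + 2) * a) * polygammaSum (expansionCoeff (k + 1)) (k + 1) s a) a := by
  have ha0 : a ≠ 0 := by
    rintro rfl
    simp at ha
  have hpi : (Real.pi : ℂ) ≠ 0 := by exact_mod_cast Real.pi_ne_zero
  have hz : 0 < (a / (2 * Real.pi) + s).re := by
    have h : a / (2 * Real.pi) = ((1 / (2 * Real.pi) : ℝ) : ℂ) * a := by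
      push_cast
      ring
    rw [h, Complex.add_re, Complex.re_ofReal_mul, Complex.ofReal_re]
    have := Real.pi_pos
    positivity
  obtain ⟨P, hP⟩ : ∃ P : ℕ → ℂ, P = fun i => polygamma i (a / (2 * Real.pi) + s) := ⟨_, rfl⟩
  -- Product rule: `A i` differentiates the power of `a`, `D i` the polygamma. Since `D i` carries
  -- order `i + 2`, it pairs with `A (i + 1)`, and this pairing is the coefficient recursion.
  obtain ⟨A, hA⟩ : ∃ A : ℕ → ℂ, A = fun i => -(2 * (k : ℂ) + 1 - i) * ((-1) ^ (i + 1) *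
    (expansionCoeff k (i + 1) : ℂ) * (1 / (a ^ (2 * k + 2 - i) * (Real.pi : ℂ) ^ (i + 1))) *
      P (i + 1)) := ⟨_, rfl⟩
  obtain ⟨D, hD⟩ : ∃ D : ℕ → ℂ, D = fun i => (-1 : ℂ) ^ (i + 1) *
    (expansionCoeff k (i + 1) : ℂ) * (1 / (a ^ (2 * k + 1 - i) * (Real.pi : ℂ) ^ (i + 1))) *
      (P (i + 2) / (2 * Real.pi)) := ⟨_, rfl⟩
  have h1 : HasDerivAt (polygammaSum (expansionCoeff k) k s)
      (∑ i ∈ Finset.range (k + 1), (A i + D i)) a := by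
    refine HasDerivAt.fun_sum fun i hi => ?_
    have hik : i ≤ k := Nat.lt_succ_iff.mp (Finset.mem_range.mp hi)
    have hin : HasDerivAt (fun a : ℂ => a / (2 * Real.pi) + s) (1 / (2 * Real.pi)) a :=
      ((hasDerivAt_id a).div_const _).add_const _
    have hp := (hasDerivAt_polygamma (i + 1) hz).comp a hin
    have hq := hasDerivAt_div_pow
      ((-1 : ℂ) ^ (i + 1) * (expansionCoeff k (i + 1) : ℂ) / (Real.pi : ℂ) ^ (i + 1))
      (2 * k + 1 - i) ha0
    have hm := hq.mul hp
    convert! hm using 1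
    · funext y
      simp only [Pi.mul_apply, Function.comp_apply]
      field_simp
    · simp only [Function.comp_apply, hA, hD, hP]
      rw [show 2 * k + 2 - i = 2 * k + 1 - i + 1 by omega, Nat.cast_sub (by omega)]
      push_cast
      field_simp
  have h2 : ∀ i ∈ Finset.range (k + 1), -(2 * ((k : ℂ) + 2) * a) * ((-1 : ℂ) ^ (i + 1 + 1) *
      (expansionCoeff (k + 1) (i + 1 + 1) : ℂ) *
      (1 / (a ^ (2 * (k + 1) + 1 - (i + 1)) * (Real.pi : ℂ) ^ (i + 1 + 1))) * P (i + 1 + 1)) =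
      A (i + 1) + D i := by
    intro i hi
    have hik : i ≤ k := Nat.lt_succ_iff.mp (Finset.mem_range.mp hi)
    have hk : (k : ℂ) + 2 ≠ 0 := by exact_mod_cast (Nat.succ_ne_zero (k + 1))
    have hk2 : 2 * (k : ℂ) + 4 ≠ 0 := by exact_mod_cast (Nat.succ_ne_zero (2 * k + 3))
    simp only [hA, hD]
    rw [expansionCoeff, show 2 * (k + 1) + 1 - (i + 1) = 2 * k + 1 - i + 1 by omega,
      show 2 * k + 2 - (i + 1) = 2 * k + 1 - i by omega]
    push_cast
    rw [show 2 * (k : ℂ) + 4 = 2 * (k + 2) by ring]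
    field_simp
    ring
  have h3 : -(2 * ((k : ℂ) + 2) * a) * ((-1 : ℂ) ^ (0 + 1) *
      (expansionCoeff (k + 1) (0 + 1) : ℂ) *
      (1 / (a ^ (2 * (k + 1) + 1 - 0) * (Real.pi : ℂ) ^ (0 + 1))) * P (0 + 1)) = A 0 := by
    have hk : (k : ℂ) + 2 ≠ 0 := by exact_mod_cast (Nat.succ_ne_zero (k + 1))
    simp only [hA]
    rw [zero_add, expansionCoeff, show 2 * (k + 1) + 1 - 0 = 2 * k + 2 - 0 + 1 by omega]
    push_cast
    rw [show 2 * (k : ℂ) + 4 = 2 * (k + 2) by ring]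
    field_simp
    ring
  have h4 : A (k + 1) = 0 := by
    simp only [hA]
    rw [expansionCoeff_eq_zero le_rfl]
    simp
  convert h1 using 1
  rw [polygammaSum, Finset.mul_sum, Finset.sum_range_succ']
  subst hP
  rw [Finset.sum_congr rfl h2, h3, Finset.sum_add_distrib, Finset.sum_add_distrib,
    add_right_comm, ← Finset.sum_range_succ', Finset.sum_range_succ, h4, add_zero]

/-- Both families obey `f_(k+1) = -f_k' / (2(k+2)a)` with `k + 2 = j`, so agreement at `k = 0`
propagates. -/
theorem eq_of_deriv_recursion {h : ℕ → ℝ → ℝ} {R : ℕ → ℂ → ℂ}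
    (hh : ∀ k a, 0 < a → HasDerivAt (h k) (-(2 * ((k : ℝ) + 2) * a) * h (k + 1) a) a)
    (hR : ∀ k (a : ℂ), 0 < a.re → HasDerivAt (R k) (-(2 * ((k : ℂ) + 2) * a) * R (k + 1) a) a)
    (h0 : ∀ a : ℝ, 0 < a → (h 0 a : ℂ) = R 0 a) (k : ℕ) :
    ∀ a : ℝ, 0 < a → (h k a : ℂ) = R k a := by
  induction k with
  | zero => exact h0
  | succ k ih =>
    intro a ha
    have h1 := (hR k a (by simpa using ha)).comp_ofReal
    have h2 := (hh k a ha).ofReal_comp.congr_of_eventuallyEq (f₁ := fun a : ℝ => R k a) (by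
      filter_upwards [Ioi_mem_nhds ha] with y hy using (ih y hy).symm)
    have h3 := h1.unique h2
    push_cast at h3
    have hk : (k : ℂ) + 2 ≠ 0 := by exact_mod_cast (Nat.succ_ne_zero (k + 1))
    have hac : (a : ℂ) ≠ 0 := by exact_mod_cast ha.ne'
    exact (mul_left_cancel₀ (neg_ne_zero.mpr (mul_ne_zero (mul_ne_zero two_ne_zero hk) hac)) h3).symm

theorem hasDerivAt_expansionCoeff_zero_div (k : ℕ) {a : ℂ} (ha : a ≠ 0) :
    HasDerivAt (fun a : ℂ => (expansionCoeff k 0 : ℂ) / a ^ (2 * k + 2))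
      (-(2 * (k + 2) * a) * ((expansionCoeff (k + 1) 0 : ℂ) / a ^ (2 * (k + 1) + 2))) a := by
  convert! hasDerivAt_div_pow (expansionCoeff k 0 : ℂ) (2 * k + 2) ha using 1
  have hk : (k : ℂ) + 2 ≠ 0 := by exact_mod_cast (Nat.succ_ne_zero (k + 1))
  rw [expansionCoeff]
  push_cast
  field_simp
  ring

theorem hasDerivAt_leadingCoeffMinus_div (k : ℕ) {a : ℂ} (ha : a ≠ 0) :
    HasDerivAt (fun a : ℂ => (leadingCoeffMinus k : ℂ) * Real.pi / a ^ (2 * k + 3))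
      (-(2 * (k + 2) * a) *
        ((leadingCoeffMinus (k + 1) : ℂ) * Real.pi / a ^ (2 * (k + 1) + 3))) a := by
  convert! hasDerivAt_div_pow ((leadingCoeffMinus k : ℂ) * Real.pi) (2 * k + 3) ha using 1
  have hk : (k : ℂ) + 2 ≠ 0 := by exact_mod_cast (Nat.succ_ne_zero (k + 1))
  rw [leadingCoeffMinus]
  push_cast
  rw [show 2 * (k : ℂ) + 4 = 2 * (k + 2) by ring]
  field_simp
  ring

theorem polygammaSum_zero {s a : ℝ} (hs : 0 ≤ s) (ha : 0 < a) :
    polygammaSum (expansionCoeff 0) 0 s a =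
      ((-(trigammaSeries (a / (2 * Real.pi) + s) / (8 * Real.pi * a)) : ℝ) : ℂ) := by
  have h := polygamma_one_ofReal (x := a / (2 * Real.pi) + s) (by positivity)
  push_cast at h
  have hac : (a : ℂ) ≠ 0 := by exact_mod_cast ha.ne'
  have hpi : (Real.pi : ℂ) ≠ 0 := by exact_mod_cast Real.pi_ne_zero
  simp only [polygammaSum, zero_add, Finset.sum_range_one, pow_one, mul_zero, Nat.sub_zero, h,
    expansionCoeff]
  push_cast
  field_simp

theorem isPlusExpansion_expansionCoeff (k : ℕ) : IsPlusExpansion (k + 2) (expansionCoeff k) := by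
  rw [isPlusExpansion_iff]
  have hs : ((1 / 2 : ℝ) : ℂ) = 1 / 2 := by norm_num
  refine eq_of_deriv_recursion (h := fun k => hatPlus 1 (k + 2) 1)
    (R := fun k a => (expansionCoeff k 0 : ℂ) / a ^ (2 * k + 2) +
      polygammaSum (expansionCoeff k) k (1 / 2) a) (fun k a ha => ?_) (fun k a ha => ?_)
    (fun a ha => ?_) k
  · simpa using hasDerivAt_hatPlus (j := k + 2) (by omega) ha
  · have ha0 : a ≠ 0 := by
      rintro rfl
      simp at ha
    have h := (hasDerivAt_expansionCoeff_zero_div k ha0).add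
      (hasDerivAt_polygammaSum k (s := 1 / 2) (by norm_num) ha)
    rw [hs, ← mul_add] at h
    exact h
  · have h := polygammaSum_zero (s := 1 / 2) (by norm_num) ha
    rw [hs] at h
    have hac : (a : ℂ) ≠ 0 := by exact_mod_cast ha.ne'
    simp only [zero_add, h, hatPlus_two ha, expansionCoeff]
    push_cast
    field_simp
    ring

/-- The coefficients of the expansion of `Î⁻` for `j = k + 2`, indexed from `-1`. -/
noncomputable def expansionCoeffMinus (k : ℕ) : ℤ → ℝ
  | Int.ofNat i => expansionCoeff k i
  | Int.negSucc _ => leadingCoeffMinus k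

theorem isMinusExpansion_expansionCoeffMinus (k : ℕ) :
    IsMinusExpansion (k + 2) (expansionCoeffMinus k) := by
  rw [isMinusExpansion_iff]
  refine eq_of_deriv_recursion (h := fun k => hatMinus 1 (k + 2) 1)
    (R := fun k a => -((leadingCoeffMinus k : ℂ) * Real.pi / (a : ℂ) ^ (2 * k + 3)) -
      (expansionCoeff k 0 : ℂ) / (a : ℂ) ^ (2 * k + 2) -
        polygammaSum (expansionCoeff k) k 0 a) (fun k a ha => ?_) (fun k a ha => ?_)
    (fun a ha => ?_) k
  · simpa using hasDerivAt_hatMinus (j := k + 2) (by omega) ha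
  · have ha0 : a ≠ 0 := by
      rintro rfl
      simp at ha
    have h := ((hasDerivAt_leadingCoeffMinus_div k ha0).neg.sub
      (hasDerivAt_expansionCoeff_zero_div k ha0)).sub (hasDerivAt_polygammaSum k le_rfl ha)
    rw [Complex.ofReal_zero, ← mul_neg, ← mul_sub, ← mul_sub] at h
    exact h
  · have h := polygammaSum_zero le_rfl ha
    rw [Complex.ofReal_zero] at h
    have hac : (a : ℂ) ≠ 0 := by exact_mod_cast ha.ne'
    simp only [zero_add, h, hatMinus_two ha, expansionCoeff, leadingCoeffMinus, add_zero]
    push_cast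
    field_simp
    ring

/-! ### Uniqueness of the coefficients. -/

theorem tendsto_polygamma_add_one (i : ℕ) :
    Tendsto (fun t : ℝ => polygamma i ((t : ℂ) + 1)) (𝓝[>] 0) (𝓝 (polygamma i 1)) := by
  have h1 : ContinuousAt (polygamma i) ((0 : ℝ) + 1 : ℂ) :=
    (analyticOnNhd_polygamma i _ (by simp)).continuousAt
  have h2 : ContinuousAt (fun t : ℝ => (t : ℂ) + 1) 0 := by fun_prop
  have h3 := ContinuousAt.comp (f := fun t : ℝ => (t : ℂ) + 1) h1 h2
  have h4 := h3.tendsto.mono_left (nhdsWithin_le_nhds (s := Set.Ioi 0))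
  simpa using! h4

theorem tendsto_ofReal_pow_succ (n : ℕ) :
    Tendsto (fun t : ℝ => (t : ℂ) ^ (n + 1)) (𝓝[>] 0) (𝓝 0) := by
  have h : ContinuousAt (fun t : ℝ => (t : ℂ) ^ (n + 1)) 0 := by fun_prop
  simpa using h.tendsto.mono_left (nhdsWithin_le_nhds (s := Set.Ioi 0))

theorem pow_mul_polygamma_eq (i : ℕ) {t : ℝ} (ht : 0 < t) :
    (t : ℂ) ^ (i + 1) * polygamma i t =
      (t : ℂ) ^ (i + 1) * polygamma i (t + 1) - (-1) ^ i * i.factorial := by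
  have h0 : (t : ℂ) ≠ 0 := by exact_mod_cast ht.ne'
  rw [polygamma_add_one i (by simpa using ht)]
  field_simp
  ring

theorem tendsto_pow_mul_polygamma (i : ℕ) :
    Tendsto (fun t : ℝ => (t : ℂ) ^ (i + 1) * polygamma i t) (𝓝[>] 0)
      (𝓝 (-((-1) ^ i * i.factorial))) := by
  have h := ((tendsto_ofReal_pow_succ i).mul (tendsto_polygamma_add_one i)).sub_const
    ((-1 : ℂ) ^ i * i.factorial)
  rw [zero_mul, zero_sub] at h
  refine h.congr' ?_
  filter_upwards [self_mem_nhdsWithin] with t ht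
  exact (pow_mul_polygamma_eq i ht).symm

theorem tendsto_pow_mul_polygamma_of_lt {i n : ℕ} (h : i + 1 < n) :
    Tendsto (fun t : ℝ => (t : ℂ) ^ n * polygamma i t) (𝓝[>] 0) (𝓝 0) := by
  obtain ⟨m, rfl⟩ := Nat.exists_eq_add_of_lt h
  have h1 := (tendsto_ofReal_pow_succ m).mul (tendsto_pow_mul_polygamma i)
  rw [zero_mul] at h1
  refine h1.congr fun t => ?_
  ring

/-- At `0` the top term has a pole of order `m + 2` (for `m + 1` terms), the others have smaller
order, `q` is entire, and `r ≠ 0` keeps `(w - r)^(e i)` from vanishing. Multiplying by `t^(m+2)` and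
letting `t → 0+` isolates the top coefficient. -/
theorem coeff_eq_zero_of_sum_polygamma_eq_zero {q : ℂ → ℂ} (hq : Differentiable ℂ q) {r : ℂ}
    (hr : r ≠ 0) (e : ℕ → ℕ) (d : ℕ → ℂ) (m : ℕ)
    (h : ∀ w : ℂ, 0 < w.re →
      q w + ∑ i ∈ Finset.range m, d i * (w - r) ^ e i * polygamma (i + 1) w = 0) :
    ∀ i < m, d i = 0 := by
  induction m with
  | zero => simp
  | succ m ih =>
    have hcont : ∀ f : ℂ → ℂ, Continuous f →
        Tendsto (fun t : ℝ => f t) (𝓝[>] 0) (𝓝 (f 0)) := fun f hf => by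
      have h : Continuous fun t : ℝ => f t := hf.comp Complex.continuous_ofReal
      simpa using (h.tendsto 0).mono_left (nhdsWithin_le_nhds (s := Set.Ioi 0))
    have t1 : Tendsto (fun t : ℝ => (t : ℂ) ^ (m + 1 + 1) * q t) (𝓝[>] 0) (𝓝 0) := by
      simpa using (tendsto_ofReal_pow_succ (m + 1)).mul (hcont q hq.continuous)
    have t2 : Tendsto (fun t : ℝ => ∑ i ∈ Finset.range m,
        d i * ((t : ℂ) - r) ^ e i * ((t : ℂ) ^ (m + 1 + 1) * polygamma (i + 1) t)) (𝓝[>] 0)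
        (𝓝 0) := by
      have := tendsto_finsetSum (Finset.range m) fun i (hi : i ∈ Finset.range m) =>
        (hcont (fun w => d i * (w - r) ^ e i) (by fun_prop)).mul
          (tendsto_pow_mul_polygamma_of_lt (i := i + 1) (n := m + 1 + 1)
            (by have := Finset.mem_range.mp hi; omega))
      simpa using this
    have t3 := (hcont (fun w => d m * (w - r) ^ e m) (by fun_prop)).mul
      (tendsto_pow_mul_polygamma (m + 1))
    have t4 := (t1.add t2).add t3
    have hm : d m = 0 := by
      have h0 := tendsto_nhds_unique (t4.congr' (f₂ := fun _ => 0) (by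
        filter_upwards [self_mem_nhdsWithin] with t ht
        have := h t (by simpa using ht)
        rw [Finset.sum_range_succ] at this
        have h' : ∑ i ∈ Finset.range m,
            d i * ((t : ℂ) - r) ^ e i * ((t : ℂ) ^ (m + 1 + 1) * polygamma (i + 1) t) =
            (t : ℂ) ^ (m + 1 + 1) *
              ∑ i ∈ Finset.range m, d i * ((t : ℂ) - r) ^ e i * polygamma (i + 1) t := by
          rw [Finset.mul_sum]
          exact Finset.sum_congr rfl fun i _ => by ring
        rw [h']
        linear_combination (t : ℂ) ^ (m + 1 + 1) * this)) tendsto_const_nhds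
      have hf : ((m + 1).factorial : ℂ) ≠ 0 := by exact_mod_cast Nat.factorial_ne_zero _
      simpa [hr, hf] using h0
    intro i hi
    rcases Nat.lt_succ_iff_lt_or_eq.mp hi with hi | rfl
    · refine ih (fun w hw => ?_) i hi
      have := h w hw
      rwa [Finset.sum_range_succ, hm, zero_mul, zero_mul, add_zero] at this
    · exact hm

/-- The integrals give the relation only for real `w > w₀`; the identity theorem carries it to the
half-plane, hence down to the pole at `0`. -/
theorem coeff_eq_zero_of_sum_polygamma_ofReal_eq_zero {q : ℂ → ℂ} (hq : Differentiable ℂ q)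
    {r : ℂ} (hr : r ≠ 0) (e : ℕ → ℕ) (d : ℕ → ℂ) (m : ℕ) {w₀ : ℝ} (hw₀ : 0 ≤ w₀)
    (h : ∀ w : ℝ, w₀ < w →
      q w + ∑ i ∈ Finset.range m, d i * ((w : ℂ) - r) ^ e i * polygamma (i + 1) w = 0) :
    ∀ i < m, d i = 0 := by
  refine coeff_eq_zero_of_sum_polygamma_eq_zero hq hr e d m ?_
  have han : AnalyticOnNhd ℂ (fun w => q w +
      ∑ i ∈ Finset.range m, d i * (w - r) ^ e i * polygamma (i + 1) w) {w : ℂ | 0 < w.re} := by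
    refine DifferentiableOn.analyticOnNhd (hq.differentiableOn.add ?_) isOpen_re_pos
    refine DifferentiableOn.fun_sum fun i _ => DifferentiableOn.mul ?_
      (analyticOnNhd_polygamma (i + 1)).differentiableOn
    exact Differentiable.differentiableOn (by fun_prop)
  have hpre : IsPreconnected {w : ℂ | 0 < w.re} := (convex_halfSpace_re_gt 0).isPreconnected
  have hfreq : ∃ᶠ w : ℂ in 𝓝[≠] ((w₀ + 1 : ℝ) : ℂ), q w +
      ∑ i ∈ Finset.range m, d i * (w - r) ^ e i * polygamma (i + 1) w = (fun _ => (0 : ℂ)) w := by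
    have ht : Tendsto (fun t : ℝ => (t : ℂ)) (𝓝[>] (w₀ + 1)) (𝓝[≠] ((w₀ + 1 : ℝ) : ℂ)) := by
      refine tendsto_nhdsWithin_iff.mpr
        ⟨Complex.continuous_ofReal.continuousAt.tendsto.mono_left nhdsWithin_le_nhds, ?_⟩
      filter_upwards [self_mem_nhdsWithin] with t ht
      have ht' : w₀ + 1 < t := ht
      simpa using! Complex.ofReal_injective.ne ht'.ne'
    refine ht.frequently (Eventually.frequently ?_)
    filter_upwards [self_mem_nhdsWithin] with t ht
    have ht' : w₀ + 1 < t := ht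
    exact h t (by linarith)
  intro w hw
  exact han.eqOn_of_preconnected_of_frequently_eq analyticOnNhd_const hpre
    (by simp only [Set.mem_ofPred_eq, Complex.ofReal_re]; linarith) hfreq hw

theorem IsPlusExpansion.unique {k : ℕ} {c c' : ℕ → ℝ} (hc : IsPlusExpansion (k + 2) c)
    (hc' : IsPlusExpansion (k + 2) c') {i : ℕ} (hi : i ≤ k + 1) : c i = c' i := by
  rw [isPlusExpansion_iff] at hc hc'
  have hpi : (Real.pi : ℂ) ≠ 0 := by exact_mod_cast Real.pi_ne_zero
  -- Multiply by `a^(2k+2)` and put `w = a/(2π) + 1/2`, so that `r = 1/2`; the powers of `π` cancel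
  -- and leave `(-2)^(i+1)`.
  have key : ∀ w : ℝ, 1 / 2 < w → ((c 0 - c' 0 : ℝ) : ℂ) + ∑ i ∈ Finset.range (k + 1),
      ((-2 : ℂ) ^ (i + 1) * ((c (i + 1) - c' (i + 1) : ℝ) : ℂ)) * ((w : ℂ) - 1 / 2) ^ (i + 1) *
        polygamma (i + 1) w = 0 := by
    intro w hw
    obtain ⟨a, ha⟩ : ∃ a : ℝ, a = 2 * Real.pi * (w - 1 / 2) := ⟨_, rfl⟩
    have ha0 : 0 < a := by
      rw [ha]
      have : 0 < w - 1 / 2 := by linarith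
      positivity
    have hac : (a : ℂ) ≠ 0 := by exact_mod_cast ha0.ne'
    have haw : (w : ℂ) - 1 / 2 = a / (2 * Real.pi) := by
      rw [ha]
      push_cast
      field_simp
    have hw2 : (a : ℂ) / (2 * Real.pi) + 1 / 2 = w := by
      rw [← haw]
      ring
    have h := (hc a ha0).symm.trans (hc' a ha0)
    have h1 : ∀ c : ℕ → ℝ, (a : ℂ) ^ (2 * k + 2) * ((c 0 : ℂ) / (a : ℂ) ^ (2 * k + 2) +
        polygammaSum c k (1 / 2) a) = c 0 + ∑ i ∈ Finset.range (k + 1),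
      ((-2 : ℂ) ^ (i + 1) * (c (i + 1) : ℂ)) * ((w : ℂ) - 1 / 2) ^ (i + 1) *
        polygamma (i + 1) w := by
      intro c
      rw [mul_add, mul_div_cancel₀ _ (pow_ne_zero _ hac), polygammaSum, Finset.mul_sum]
      congr 1
      refine Finset.sum_congr rfl fun i hi => ?_
      have hik : i < k + 1 := Finset.mem_range.mp hi
      rw [hw2, haw, show 2 * k + 2 = (2 * k + 1 - i) + (i + 1) by omega, pow_add, div_pow,
        mul_pow, neg_pow (2 : ℂ)]
      field_simp
    have h2 := congrArg (fun z => (a : ℂ) ^ (2 * k + 2) * z) h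
    simp only [h1] at h2
    rw [← sub_eq_zero, add_sub_add_comm, ← Finset.sum_sub_distrib] at h2
    rw [← h2]
    push_cast
    congr 1
    exact Finset.sum_congr rfl fun i _ => by ring
  have hz := coeff_eq_zero_of_sum_polygamma_ofReal_eq_zero
    (q := fun _ => ((c 0 - c' 0 : ℝ) : ℂ)) (differentiable_const _) (by norm_num) _ _ _
    (by norm_num) key
  have hz' : ∀ i < k + 1, c (i + 1) - c' (i + 1) = 0 := fun i hi => by
    have := hz i hi
    rw [mul_eq_zero, or_iff_right (by norm_num)] at this
    exact_mod_cast this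
  rcases i with _ | i
  · have h := key 1 (by norm_num)
    rw [Finset.sum_eq_zero, add_zero] at h
    · exact sub_eq_zero.mp (by exact_mod_cast h)
    · intro i hi
      rw [hz i (Finset.mem_range.mp hi), zero_mul, zero_mul]
  · exact sub_eq_zero.mp (hz' i (by omega))

/-- In `z = a/(2π)` the factor `z^(i+2)` cancels the pole at `z = 0`. The recurrence moves to `w = z
+ 1`, so `r = 1` and the pole at `w = 0`, that is `z = -1`, is used instead. -/
theorem IsMinusExpansion.unique {k : ℕ} {c c' : ℤ → ℝ} (hc : IsMinusExpansion (k + 2) c)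
    (hc' : IsMinusExpansion (k + 2) c') {i : ℕ} (hi : i ≤ k + 1) : c i = c' i := by
  rw [isMinusExpansion_iff] at hc hc'
  have hpi : (Real.pi : ℂ) ≠ 0 := by exact_mod_cast Real.pi_ne_zero
  obtain ⟨δ, hδ⟩ : ∃ δ : ℤ → ℝ, δ = fun i => c i - c' i := ⟨_, rfl⟩
  -- `K` collects the constants that the recurrence produces.
  obtain ⟨K, hK⟩ : ∃ K : ℂ, K = ∑ i ∈ Finset.range (k + 1), (-1 : ℂ) ^ (i + 1) *
      (δ ((i + 1 : ℕ) : ℤ) : ℂ) * (2 ^ (i + 2) * Real.pi) *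
        ((-1) ^ (i + 1) * (i + 1).factorial) := ⟨_, rfl⟩
  have key : ∀ w : ℝ, 1 < w → (((δ (-1) : ℂ) * Real.pi - K) + δ 0 * (2 * Real.pi) * (w - 1)) +
      ∑ i ∈ Finset.range (k + 1), ((-1 : ℂ) ^ (i + 1) * (δ ((i + 1 : ℕ) : ℤ) : ℂ) *
        (2 ^ (i + 2) * Real.pi)) * ((w : ℂ) - 1) ^ (i + 2) * polygamma (i + 1) w = 0 := by
    intro w hw
    obtain ⟨a, ha⟩ : ∃ a : ℝ, a = 2 * Real.pi * (w - 1) := ⟨_, rfl⟩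
    obtain ⟨z, hz⟩ : ∃ z : ℝ, z = w - 1 := ⟨_, rfl⟩
    have hz0 : 0 < z := by linarith
    have hzc : (z : ℂ) ≠ 0 := by exact_mod_cast hz0.ne'
    have hwz : (w : ℂ) = z + 1 := by
      rw [hz]
      push_cast
      ring
    rw [← hz] at ha
    have ha0 : 0 < a := by
      rw [ha]
      positivity
    have hac : (a : ℂ) = 2 * Real.pi * z := by
      rw [ha]
      push_cast
      ring
    have hac0 : (a : ℂ) ≠ 0 := by exact_mod_cast ha0.ne'
    have hw2 : (a : ℂ) / (2 * Real.pi) + 0 = z := by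
      rw [hac]
      field_simp
      ring
    have h := (hc a ha0).symm.trans (hc' a ha0)
    have h1 : ∀ c : ℤ → ℝ, (a : ℂ) ^ (2 * k + 3) * (-((c (-1) : ℂ) * Real.pi /
        (a : ℂ) ^ (2 * k + 3)) - (c 0 : ℂ) / (a : ℂ) ^ (2 * k + 2) -
        polygammaSum (fun i => c i) k 0 a) = -(c (-1) * Real.pi) - c 0 * a -
        ∑ i ∈ Finset.range (k + 1), (-1 : ℂ) ^ (i + 1) * (c ((i + 1 : ℕ) : ℤ) : ℂ) *
          (2 ^ (i + 2) * Real.pi) * ((z : ℂ) ^ (i + 2) * polygamma (i + 1) z) := by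
      intro c
      rw [mul_sub, mul_sub, mul_neg, mul_div_cancel₀ _ (pow_ne_zero _ hac0), polygammaSum,
        Finset.mul_sum]
      congr 1
      · congr 1
        field_simp
        ring
      · refine Finset.sum_congr rfl fun i hi => ?_
        have hik : i < k + 1 := Finset.mem_range.mp hi
        have e : (a : ℂ) ^ (2 * k + 3) = a ^ (2 * k + 1 - i) * (2 * Real.pi * z) ^ (i + 2) := by
          rw [← hac, ← pow_add]
          congr 1
          omega
        rw [hw2, e, mul_pow, mul_pow]
        field_simp
        ring
    have h2 := congrArg (fun z => (a : ℂ) ^ (2 * k + 3) * z) h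
    simp only [h1] at h2
    have h3 : (δ (-1) : ℂ) * Real.pi + δ 0 * a +
        ∑ i ∈ Finset.range (k + 1), (-1 : ℂ) ^ (i + 1) * (δ ((i + 1 : ℕ) : ℤ) : ℂ) *
          (2 ^ (i + 2) * Real.pi) * ((z : ℂ) ^ (i + 2) * polygamma (i + 1) z) = 0 := by
      simp only [hδ]
      push_cast at h2 ⊢
      simp only [mul_sub, sub_mul, Finset.sum_sub_distrib] at h2 ⊢
      linear_combination -h2
    have h4 : ∑ i ∈ Finset.range (k + 1), ((-1 : ℂ) ^ (i + 1) * (δ ((i + 1 : ℕ) : ℤ) : ℂ) *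
        (2 ^ (i + 2) * Real.pi)) * ((w : ℂ) - 1) ^ (i + 2) * polygamma (i + 1) w =
        ∑ i ∈ Finset.range (k + 1), (-1 : ℂ) ^ (i + 1) * (δ ((i + 1 : ℕ) : ℤ) : ℂ) *
          (2 ^ (i + 2) * Real.pi) * ((z : ℂ) ^ (i + 2) * polygamma (i + 1) z) + K := by
      rw [hK, ← Finset.sum_add_distrib]
      refine Finset.sum_congr rfl fun i _ => ?_
      have h5 := pow_mul_polygamma_eq (i + 1) hz0
      rw [hwz, add_sub_cancel_right]
      linear_combination -((-1 : ℂ) ^ (i + 1) * (δ ((i + 1 : ℕ) : ℤ) : ℂ) *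
        (2 ^ (i + 2) * Real.pi)) * h5
    rw [h4, ← h3, hac, hwz]
    ring
  have hz := coeff_eq_zero_of_sum_polygamma_ofReal_eq_zero
    (q := fun w => ((δ (-1) : ℂ) * Real.pi - K) + δ 0 * (2 * Real.pi) * (w - 1)) (by fun_prop)
    one_ne_zero (fun i => i + 2) _ _ zero_le_one key
  have hz' : ∀ i < k + 1, δ ((i + 1 : ℕ) : ℤ) = 0 := fun i hi => by
    have := hz i hi
    rw [mul_eq_zero, or_iff_left (by simp [hpi]), mul_eq_zero, or_iff_right (by norm_num)] at this
    exact_mod_cast this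
  rcases i with _ | i
  · have hs : ∀ w : ℝ, 1 < w →
        ((δ (-1) : ℂ) * Real.pi - K) + δ 0 * (2 * Real.pi) * (w - 1) = 0 := by
      intro w hw
      have h := key w hw
      rwa [Finset.sum_eq_zero, add_zero] at h
      intro i hi
      rw [hz i (Finset.mem_range.mp hi), zero_mul, zero_mul]
    -- Only an affine function of `w` is left; two values suffice to kill its slope.
    have h2 := hs 2 (by norm_num)
    have h3 := hs 3 (by norm_num)
    have h4 : (δ 0 : ℂ) * (2 * Real.pi) = 0 := by
      push_cast at h2 h3
      linear_combination h3 - h2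
    rw [mul_eq_zero, or_iff_left (by simp [hpi])] at h4
    have h5 : δ 0 = 0 := by exact_mod_cast h4
    rw [hδ] at h5
    exact sub_eq_zero.mp h5
  · have h5 := hz' i (by omega)
    rw [hδ] at h5
    exact sub_eq_zero.mp h5

/-! ### The recursion characterizes the coefficients; conclusion. -/

theorem plusRecursion_expansionCoeff {γ : ℕ → ℕ → ℝ}
    (h : ∀ k i, i ≤ k + 1 → γ (k + 2) i = expansionCoeff k i) : PlusRecursion γ := by
  refine ⟨?_, ?_, fun j hj => ?_⟩
  · simpa [expansionCoeff] using h 0 0 (by norm_num)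
  · simpa [expansionCoeff] using h 0 1 (by norm_num)
  · obtain ⟨k, rfl⟩ := Nat.exists_eq_add_of_lt hj
    rw [show 2 + k + 1 = k + 1 + 2 by ring, show k + 1 + 2 - 1 = k + 2 by omega,
      show k + 1 + 2 - 2 = k + 1 by omega]
    refine ⟨?_, ?_, fun i hi hik => ?_, ?_⟩
    · rw [h _ _ (by omega), h _ _ (by omega), expansionCoeff]
      push_cast
      ring
    · rw [h _ _ (by omega), h _ _ (by omega), expansionCoeff]
      push_cast
      ring
    · obtain ⟨i, rfl⟩ := Nat.exists_eq_add_of_le' hi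
      rw [show i + 2 - 1 = i + 1 by omega, h _ _ (by omega), h _ _ (by omega), h _ _ (by omega),
        expansionCoeff]
      push_cast
      ring
    · rw [h _ _ (by omega), h _ _ (by omega), expansionCoeff, expansionCoeff_eq_zero le_rfl]
      push_cast
      ring

theorem PlusRecursion.eq_expansionCoeff {γ : ℕ → ℕ → ℝ} (h : PlusRecursion γ) (k : ℕ) :
    ∀ i, i ≤ k + 1 → γ (k + 2) i = expansionCoeff k i := by
  induction k with
  | zero =>
    intro i hi
    interval_cases i
    · rw [h.1, expansionCoeff]
    · rw [h.2.1, expansionCoeff]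
  | succ k ih =>
    intro i hi
    obtain ⟨h0, h1, h2, h3⟩ := h.2.2 (k + 1 + 2) (by omega)
    rw [show k + 1 + 2 - 1 = k + 2 by omega] at h0 h1 h2 h3
    rw [show k + 1 + 2 - 2 = k + 1 by omega] at h3
    rcases i with _ | _ | i
    · rw [h0, ih 0 (by omega), expansionCoeff]
      push_cast
      ring
    · rw [zero_add, h1, ih 1 (by omega), expansionCoeff]
      push_cast
      ring
    · rw [expansionCoeff]
      -- The index is now `i + 2` with `j = k + 3`: `i < k` is the middle case, `i = k` the top one.
      rcases Nat.lt_or_ge i k with hik | hik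
      · rw [h2 (i + 1 + 1) (by omega) (by omega), ih _ (by omega),
          show i + 1 + 1 - 1 = i + 1 by omega, ih _ (by omega)]
        push_cast
        ring
      · obtain rfl : i = k := by omega
        rw [expansionCoeff_eq_zero (i := i + 2) le_rfl, h3, ih _ (by omega)]
        push_cast
        ring

theorem isPlusExpansion_congr {k : ℕ} {c c' : ℕ → ℝ} (h : ∀ i, i ≤ k + 1 → c i = c' i)
    (hc : IsPlusExpansion (k + 2) c) : IsPlusExpansion (k + 2) c' := by
  intro b μ hb hμ
  rw [hc b μ hb hμ, h 0 (by omega)]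
  congr 1
  refine Finset.sum_congr rfl fun i hi => ?_
  rw [h i (by have := (Finset.mem_Icc.mp hi).2; omega)]

theorem forall_two_le_iff {p : ℕ → Prop} : (∀ j, 2 ≤ j → p j) ↔ ∀ k, p (k + 2) :=
  ⟨fun h k => h _ (by omega), fun h j hj => by
    obtain ⟨k, rfl⟩ := Nat.exists_eq_add_of_le' hj
    exact h k⟩

theorem mainTheorem2 :
    (∀ j : ℕ, 2 ≤ j → ∀ b μ : ℝ, 0 < b → 0 < μ →
      MeasureTheory.IntegrableOn (kernelPlus 1 j 1 b μ) (Set.Ioi 0) ∧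
      MeasureTheory.IntegrableOn (kernelMinus 1 j 1 b μ) (Set.Ioi 0) ∧
      assocPlus 1 j 1 b μ = μ ^ (2 * j - 2) * hatPlus 1 j 1 (b * μ)) ∧
    (∃ γp : ℕ → ℕ → ℝ, ∀ j : ℕ, 2 ≤ j → IsPlusExpansion j (γp j)) ∧
    (∀ γp : ℕ → ℕ → ℝ,
      (∀ j : ℕ, 2 ≤ j → IsPlusExpansion j (γp j)) ↔ PlusRecursion γp) ∧
    (∃ γm : ℕ → ℤ → ℝ, ∀ j : ℕ, 2 ≤ j → IsMinusExpansion j (γm j)) ∧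
    (∀ (γp : ℕ → ℕ → ℝ) (γm : ℕ → ℤ → ℝ),
      (∀ j : ℕ, 2 ≤ j → IsPlusExpansion j (γp j)) →
      (∀ j : ℕ, 2 ≤ j → IsMinusExpansion j (γm j)) →
      ∀ j : ℕ, 2 ≤ j → ∀ i : ℕ, i ≤ j - 1 → γp j i = γm j (i : ℤ)) := by
  refine ⟨fun j hj b μ hb hμ => ⟨integrableOn_kernelPlus (by omega) hb hμ,
    integrableOn_kernelMinus (by omega) hb hμ, assocPlus_scaling (by omega) b hμ⟩,
    ⟨fun j => expansionCoeff (j - 2), forall_two_le_iff.mpr isPlusExpansion_expansionCoeff⟩,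
    fun γp => ?_, ⟨fun j => expansionCoeffMinus (j - 2),
      forall_two_le_iff.mpr isMinusExpansion_expansionCoeffMinus⟩, fun γp γm hp hm => ?_⟩
  · rw [forall_two_le_iff]
    exact ⟨fun h => plusRecursion_expansionCoeff fun k i hi =>
      (h k).unique (isPlusExpansion_expansionCoeff k) hi, fun h k =>
      isPlusExpansion_congr (fun i hi => (h.eq_expansionCoeff k i hi).symm)
        (isPlusExpansion_expansionCoeff k)⟩
  · rw [forall_two_le_iff] at hp hm ⊢
    intro k i hi
    rw [(hp k).unique (isPlusExpansion_expansionCoeff k) hi,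
      (hm k).unique (isMinusExpansion_expansionCoeffMinus k) hi]
    rfl
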